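/- **Notation.** Let $d\ge 1$. Write $\vee^n\mathbb C^d\subseteq(\mathbb C^d)^{\otimes n}$ for the symmetric subspace, $P_{sym}^{(n)}$ for the orthogonal projection onto it, and $d[n]=\binom{d+n-1}{n}=\dim\vee^n\mathbb C^d$. For $k\le n$ let $\operatorname{tr}_{n\to k}:\mathcal B(\vee^n\mathbb C^d)\to\mathcal B(\vee^k\mathbb C^d)$ be the partial trace over $n-k$ tensor factors, and put $$\operatorname{Clone}_{k\to n}(X)=\frac{d[k]}{d[n]}\,P_{sym}^{(n)}\bigl(X\otimes I^{\otimes(n-k)}\bigr)P_{sym}^{(n)},\qquad X\in\mathcal B(\vee^k\mathbb C^d).$$ For all $n,k\ge 0$ put $$\widetilde{\operatorname{MP}}_{n\to k}(X)=d[n]\int_{\mathcal S^{d-1}}\langle\varphi^{\otimes n}|X|\varphi^{\otimes n}\rangle\,|\varphi\rangle\langle\varphi|^{\otimes k}\,\mathrm d\varphi ,$$ where $\mathrm d\varphi$ is the uniform probability measure on the unit sphere $\mathcal S^{d-1}$ of $\mathbb C^d$. For $0\le t\le k\le n$ put $$q(n,k,t)=(-1)^{t+k}\frac{\binom{n+t}{t}\binom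 kt}{\binom nk}\frac{d[n+t]}{d[n+k]},\qquad \hat q(n,k,t)=q(n,k,t)\,\frac{d[n+k]\,d[k]}{d[n]\,d[t]} .$$ For $0\le r\le k$, the set of $(k,r,d)$-almost product vectors is $$\mathcal W_r=\bigcup_{\varphi\in\mathbb C^d}\operatorname{span}\bigl\{P_{sym}^{(k)}\bigl(\varphi^{\otimes(k-r)}\otimes\psi\bigr):\psi\in(\mathbb C^d)^{\otimes r}\bigr\},$$ and the $(k,r,d)$-almost product states are the convex combinations of the pure states $|w\rangle\langle w|$ with $w\in\mathcal W_r$, $\|w\|=1$. The diamond norm is $\|\Phi\|_\diamond=\sup_D\|\Phi\otimes\operatorname{id}_{\mathcal B(\mathbb C^D)}\|_{1\to1}$, where $\|\cdot\|_1$ is the trace norm. **Theorem.** Let $1\le k<n$ be integers and let $\delta:=\dfrac{k(k+d-1)}{n+k+d-1}$. Then $$\delta<\tfrac13\iff k<\frac{\sqrt{12n+(3d-2)^2}+4-3d}{6}.$$ Suppose that $\delta<\frac13$, let $0\le r\le k$, and let $\varepsilon_r:=\sum_{s=r+1}^k|\hat q(n,k,k-s)|$. Then $$\Bigl\|\operatorname{tr}_{n\to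 k}-\sum_{s=0}^r\hat q(n,k,k-s)\,\operatorname{Clone}_{k-s\to k}\circ\widetilde{\operatorname{MP}}_{n\to k-s}\Bigr\|_\diamond\le\varepsilon_r\le\frac{\delta^{r+1}}{1-3\delta}.$$ In particular, the $k$-body marginal of every state $\rho$ on $\vee^n\mathbb C^d$ is within $\varepsilon_r$, in $1$-norm, of an explicit linear combination of $(k,r,d)$-almost product states: for every $0\le s\le r$ the operator $\sigma_s:=\operatorname{Clone}_{k-s\to k}(\widetilde{\operatorname{MP}}_{n\to k-s}(\rho))$ is a $(k,r,d)$-almost product state, and $$\Bigl\|\operatorname{tr}_{n\to k}(\rho)-\sum_{s=0}^r\hat q(n,k,k-s)\,\sigma_s\Bigr\|_1\le\varepsilon_r .$$ -/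

import Mathlib

open MeasureTheory

noncomputable section

namespace DeFinetti

/-! ### Norms of operators and of maps between operator algebras -/

section Norms

variable {E F : Type*}
  [NormedAddCommGroup E] [InnerProductSpace ℂ E] [FiniteDimensional ℂ E]
  [NormedAddCommGroup F] [InnerProductSpace ℂ F] [FiniteDimensional ℂ F]

/-- The `1`-norm (trace norm) of an operator on a finite-dimensional Hilbert space: the sum of its
singular values. -/
def traceNorm (T : E →L[ℂ] E) : ℝ :=
  (T : E →ₗ[ℂ] E).singularValues.sum fun _ x => x

/-- The operator on `E ⊗ ℂ^D`, realised as the Hilbert sum of `D` copies of `E`, whose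
`(i, j)` block is `X i j`. Every operator on `E ⊗ ℂ^D` is of this form. -/
def blockOperator {D : ℕ} (X : Fin D → Fin D → (E →L[ℂ] E)) :
    (PiLp 2 fun _ : Fin D => E) →L[ℂ] (PiLp 2 fun _ : Fin D => E) :=
  LinearMap.toContinuousLinearMap
    { toFun := fun v => WithLp.toLp 2 fun i => ∑ j, X i j (v j)
      map_add' := fun u v => by
        ext i
        simp [Finset.sum_add_distrib]
      map_smul' := fun c v => by
        ext i
        simp [Finset.smul_sum] }

/-- The diamond norm: the supremum over all `D` of the norms of `Φ ⊗ id` on the operators on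
`E ⊗ ℂ^D`, both sides carrying the trace norm. In block form, `Φ ⊗ id` applies `Φ` to every
block. It takes values in `[0, ∞]`, so that no boundedness is presupposed. -/
def diamondNorm (Φ : (E →L[ℂ] E) →ₗ[ℂ] (F →L[ℂ] F)) : ENNReal :=
  ⨆ (D : ℕ) (X : Fin D → Fin D → (E →L[ℂ] E)) (_ : traceNorm (blockOperator X) ≤ 1),
    ENNReal.ofReal (traceNorm (blockOperator fun i j => Φ (X i j)))

/-- Density operators (mixed states). -/
def IsState (ρ : E →L[ℂ] E) : Prop :=
  ρ.IsPositive ∧ LinearMap.trace ℂ E (ρ : E →ₗ[ℂ] E) = 1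

end Norms

/-! ### Tensor powers of `ℂ^d` and the symmetric subspace -/

/-- `(ℂ^d)^{⊗ n}`, in coordinates with respect to the standard product basis. -/
abbrev TensorSpace (d n : ℕ) := EuclideanSpace ℂ (Fin n → Fin d)

/-- The symmetric subspace: tensors that are invariant under permutations of the factors. -/
def symSubspace (d n : ℕ) : Submodule ℂ (TensorSpace d n) where
  carrier := {v | ∀ (σ : Equiv.Perm (Fin n)) (f : Fin n → Fin d), v (f ∘ σ) = v f}
  add_mem' := by
    intro a b ha hb σ f
    simp [ha σ f, hb σ f]
  zero_mem' := by
    intro σ f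
    simp
  smul_mem' := by
    intro c a ha σ f
    simp [ha σ f]

/-- The symmetric subspace `∨^n ℂ^d` as a Hilbert space, with the inner product of
`(ℂ^d)^{⊗ n}`. -/
def Sym (d n : ℕ) : Type := symSubspace d n

instance (d n : ℕ) : NormedAddCommGroup (Sym d n) :=
  inferInstanceAs (NormedAddCommGroup (symSubspace d n))

instance (d n : ℕ) : InnerProductSpace ℂ (Sym d n) :=
  inferInstanceAs (InnerProductSpace ℂ (symSubspace d n))

instance (d n : ℕ) : FiniteDimensional ℂ (Sym d n) :=
  inferInstanceAs (FiniteDimensional ℂ (symSubspace d n))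

instance (d n : ℕ) : CompleteSpace (Sym d n) :=
  FiniteDimensional.complete ℂ (Sym d n)

/-- The inclusion of `∨^n ℂ^d` into `(ℂ^d)^{⊗ n}`. -/
def symIncl (d n : ℕ) : Sym d n →L[ℂ] TensorSpace d n :=
  (symSubspace d n).subtypeL

/-- The orthogonal projection of `(ℂ^d)^{⊗ n}` onto `∨^n ℂ^d`. -/
def symProj (d n : ℕ) : TensorSpace d n →L[ℂ] Sym d n :=
  (symSubspace d n).orthogonalProjectionOnto

/-- `d[n]`, the dimension of `∨^n ℂ^d` (for `d ≥ 1`). -/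
def symDim (d n : ℕ) : ℕ := (d + n - 1).choose n

/-- `x^{⊗ n}`, as an element of `∨^n ℂ^d`. -/
def tensorPower {d : ℕ} (n : ℕ) (x : EuclideanSpace ℂ (Fin d)) : Sym d n :=
  ⟨WithLp.toLp 2 fun f => ∏ i, x (f i), fun σ f => by
    simpa using Equiv.prod_comp σ fun i => x (f i)⟩

/-- The tensor product `u ⊗ v ∈ (ℂ^d)^{⊗ n}` of `u ∈ (ℂ^d)^{⊗ a}` and `v ∈ (ℂ^d)^{⊗ b}`, where
`a + b = n`, as a linear map in `u`. -/
def tensorWith {d a b n : ℕ} (h : a + b = n) (v : TensorSpace d b) :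
    TensorSpace d a →L[ℂ] TensorSpace d n :=
  LinearMap.toContinuousLinearMap
    { toFun := fun u => WithLp.toLp 2 fun f =>
        u (fun i => f (Fin.cast h (Fin.castAdd b i))) * v (fun j => f (Fin.cast h (Fin.natAdd a j)))
      map_add' := fun u w => by
        ext f
        simp [add_mul]
      map_smul' := fun c u => by
        ext f
        simp [mul_assoc] }

/-- The standard product basis vector `e_{c 1} ⊗ ⋯ ⊗ e_{c m}` of `(ℂ^d)^{⊗ m}`. -/
def basisTensor {d m : ℕ} (c : Fin m → Fin d) : TensorSpace d m :=
  EuclideanSpace.single c 1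

/-! ### Partial trace, cloning and measure-and-prepare maps -/

/-- An operator on `∨^n ℂ^d`, extended by zero to `(ℂ^d)^{⊗ n}`. -/
def extendOp (d n : ℕ) :
    (Sym d n →L[ℂ] Sym d n) →ₗ[ℂ] (TensorSpace d n →L[ℂ] TensorSpace d n) where
  toFun X := symIncl d n ∘L X ∘L symProj d n
  map_add' X Y := by
    ext v : 1
    simp
  map_smul' c X := by
    ext v : 1
    simp

/-- The compression `T ↦ P T P` of an operator on `(ℂ^d)^{⊗ n}` to `∨^n ℂ^d`, where `P` is the
projection onto the symmetric subspace. -/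
def compressOp (d n : ℕ) :
    (TensorSpace d n →L[ℂ] TensorSpace d n) →ₗ[ℂ] (Sym d n →L[ℂ] Sym d n) where
  toFun T := symProj d n ∘L T ∘L symIncl d n
  map_add' X Y := by
    ext v : 1
    simp
  map_smul' c X := by
    ext v : 1
    simp

/-- The partial trace over the last `n - k` tensor factors,
`T ↦ ∑_c (I ⊗ ⟨e_c|) T (I ⊗ |e_c⟩)`, on operators on the full tensor power. -/
def partialTraceFull (d : ℕ) {n k : ℕ} (h : k ≤ n) :
    (TensorSpace d n →L[ℂ] TensorSpace d n) →ₗ[ℂ] (TensorSpace d k →L[ℂ] TensorSpace d k) where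
  toFun T := ∑ c : Fin (n - k) → Fin d,
    (tensorWith (Nat.add_sub_cancel' h) (basisTensor c)).adjoint ∘L T ∘L
      tensorWith (Nat.add_sub_cancel' h) (basisTensor c)
  map_add' X Y := by
    ext v : 1
    simp [Finset.sum_add_distrib]
  map_smul' a X := by
    ext v : 1
    simp [Finset.smul_sum]

/-- The amplification `T ↦ T ⊗ I^{⊗ (n - k)} = ∑_c (I ⊗ |e_c⟩) T (I ⊗ ⟨e_c|)` on operators on the
full tensor power. -/
def tensorId (d : ℕ) {k n : ℕ} (h : k ≤ n) :
    (TensorSpace d k →L[ℂ] TensorSpace d k) →ₗ[ℂ] (TensorSpace d n →L[ℂ] TensorSpace d n) where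
  toFun T := ∑ c : Fin (n - k) → Fin d,
    tensorWith (Nat.add_sub_cancel' h) (basisTensor c) ∘L T ∘L
      (tensorWith (Nat.add_sub_cancel' h) (basisTensor c)).adjoint
  map_add' X Y := by
    ext v : 1
    simp [Finset.sum_add_distrib]
  map_smul' a X := by
    ext v : 1
    simp [Finset.smul_sum]

/-- The partial trace `tr_{n → k}` from operators on `∨^n ℂ^d` to operators on `∨^k ℂ^d`. (The
partial trace of an operator supported on `∨^n ℂ^d` is supported on `∨^k ℂ^d`.) -/
def partialTrace (d : ℕ) {n k : ℕ} (h : k ≤ n) :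
    (Sym d n →L[ℂ] Sym d n) →ₗ[ℂ] (Sym d k →L[ℂ] Sym d k) :=
  compressOp d k ∘ₗ partialTraceFull d h ∘ₗ extendOp d n

/-- The Hilbert-Schmidt adjoint of `partialTrace`: `X ↦ P (X ⊗ I^{⊗ (n - k)}) P`. -/
def partialTraceAdj (d : ℕ) {k n : ℕ} (h : k ≤ n) :
    (Sym d k →L[ℂ] Sym d k) →ₗ[ℂ] (Sym d n →L[ℂ] Sym d n) :=
  compressOp d n ∘ₗ tensorId d h ∘ₗ extendOp d k

/-- The cloning channel `Clone_{k → n}`. -/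
def clone (d : ℕ) {k n : ℕ} (h : k ≤ n) :
    (Sym d k →L[ℂ] Sym d k) →ₗ[ℂ] (Sym d n →L[ℂ] Sym d n) :=
  ((symDim d k : ℂ) / (symDim d n : ℂ)) • partialTraceAdj d h

/-- The rank-one operator `|x⟩⟨x|`. -/
def ketbra {E : Type*} [NormedAddCommGroup E] [InnerProductSpace ℂ E] (x : E) : E →L[ℂ] E :=
  InnerProductSpace.rankOne ℂ x x

/-- The complex unit sphere of `ℂ^d`. -/
abbrev CSphere (d : ℕ) := Metric.sphere (0 : EuclideanSpace ℂ (Fin d)) 1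

/-- The uniform probability measure on the complex unit sphere of `ℂ^d`: the normalised surface
measure. -/
def sphereMeasure (d : ℕ) : Measure (CSphere d) :=
  ((Measure.addHaar : Measure (EuclideanSpace ℂ (Fin d))).toSphere Set.univ)⁻¹ •
    (Measure.addHaar : Measure (EuclideanSpace ℂ (Fin d))).toSphere

theorem continuous_tensorPower (d n : ℕ) :
    Continuous fun x : CSphere d => tensorPower n (x : EuclideanSpace ℂ (Fin d)) := by
  have h : Continuous fun x : CSphere d =>
      (WithLp.toLp 2 fun f : Fin n → Fin d => ∏ i, x.1 (f i) : TensorSpace d n) := by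
    fun_prop
  exact h.subtype_mk _

theorem continuous_measurePrepare {d n : ℕ} (k : ℕ) (X : Sym d n →L[ℂ] Sym d n) :
    Continuous fun x : CSphere d =>
      inner ℂ (tensorPower n x.1) (X (tensorPower n x.1)) • ketbra (tensorPower k x.1) := by
  have h1 := continuous_tensorPower d n
  have h2 := continuous_tensorPower d k
  refine (Continuous.inner (𝕜 := ℂ) h1 (X.continuous.comp h1)).smul ?_
  refine (continuous_clm_apply (𝕜 := ℂ)).2 fun v => ?_
  simp only [ketbra, InnerProductSpace.rankOne_apply]
  exact (Continuous.inner (𝕜 := ℂ) h2 continuous_const).smul h2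

theorem integrable_measurePrepare {d n : ℕ} (k : ℕ) (X : Sym d n →L[ℂ] Sym d n) :
    Integrable (fun x : CSphere d =>
      inner ℂ (tensorPower n x.1) (X (tensorPower n x.1)) • ketbra (tensorPower k x.1))
      (sphereMeasure d) := by
  have hfin : Integrable (fun x : CSphere d =>
      inner ℂ (tensorPower n x.1) (X (tensorPower n x.1)) • ketbra (tensorPower k x.1))
      (Measure.addHaar : Measure (EuclideanSpace ℂ (Fin d))).toSphere :=
    (continuous_measurePrepare k X).integrable_of_hasCompactSupport
      (HasCompactSupport.of_compactSpace _)
  by_cases h0 : (Measure.addHaar : Measure (EuclideanSpace ℂ (Fin d))).toSphere = 0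
  · simp [sphereMeasure, h0]
  · exact hfin.smul_measure (ENNReal.inv_ne_top.2 (Measure.measure_univ_ne_zero.2 h0))

/-- The measure-and-prepare channel
`X ↦ d[n] ∫ ⟨φ^{⊗ n}| X |φ^{⊗ n}⟩ |φ⟩⟨φ|^{⊗ k} dφ` from operators on `∨^n ℂ^d` to operators on
`∨^k ℂ^d`. -/
def measurePrepare (d n k : ℕ) :
    (Sym d n →L[ℂ] Sym d n) →ₗ[ℂ] (Sym d k →L[ℂ] Sym d k) where
  toFun X := (symDim d n : ℂ) • ∫ x : CSphere d,
    inner ℂ (tensorPower n x.1) (X (tensorPower n x.1)) • ketbra (tensorPower k x.1)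
      ∂(sphereMeasure d)
  map_add' X Y := by
    rw [← smul_add, ← integral_add (integrable_measurePrepare k X) (integrable_measurePrepare k Y)]
    simp only [add_apply, inner_add_right, add_smul]
  map_smul' c X := by
    rw [RingHom.id_apply, smul_comm c]
    congr 1
    rw [← integral_smul]
    simp only [smul_apply, inner_smul_right, mul_smul]

/-! ### Coefficients -/

/-- The coefficient
`q(n,k,t) = (-1)^(t+k) * C(n+t,t) * C(k,t) / C(n,k) * d[n+t] / d[n+k]`. -/
def qCoeff (d n k t : ℕ) : ℝ :=
  (-1) ^ (t + k) * (((n + t).choose t : ℝ) * (k.choose t : ℝ) / (n.choose k : ℝ)) *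
    ((symDim d (n + t) : ℝ) / (symDim d (n + k) : ℝ))

/-- The coefficient `q̂(n,k,t) = q(n,k,t) * d[n+k] * d[k] / (d[n] * d[t])`. -/
def qHat (d n k t : ℕ) : ℝ :=
  qCoeff d n k t * ((symDim d (n + k) : ℝ) * (symDim d k : ℝ) /
    ((symDim d n : ℝ) * (symDim d t : ℝ)))

/-- The error term `ε_r = ∑_{s=r+1}^k |q̂(n,k,k-s)|`. -/
def truncationError (d n k r : ℕ) : ℝ :=
  ∑ s ∈ Finset.Icc (r + 1) k, |qHat d n k (k - s)|

/-- `δ = k(k+d-1)/(n+k+d-1)`. -/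
def deltaParam (d n k : ℕ) : ℝ :=
  (k : ℝ) * ((k : ℝ) + d - 1) / ((n : ℝ) + k + d - 1)

/-- The truncated expansion
`∑_{s=0}^r q̂(n,k,k-s) Clone_{k-s → k} ∘ MP_{n → k-s}`. -/
def truncatedExpansion (d n k r : ℕ) :
    (Sym d n →L[ℂ] Sym d n) →ₗ[ℂ] (Sym d k →L[ℂ] Sym d k) :=
  ∑ s ∈ Finset.range (r + 1),
    ((qHat d n k (k - s) : ℝ) : ℂ) •
      (clone d (Nat.sub_le k s) ∘ₗ measurePrepare d n (k - s))

/-! ### Almost product states -/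

/-- The almost product vectors along `φ`: the span of the vectors
`P_sym (φ^{⊗ (k-r)} ⊗ ψ)`, with `ψ ∈ (ℂ^d)^{⊗ r}`. -/
def almostProductSpace (d k r : ℕ) (h : r ≤ k) (φ : EuclideanSpace ℂ (Fin d)) :
    Submodule ℂ (Sym d k) :=
  Submodule.span ℂ (Set.range fun ψ : TensorSpace d r =>
    symProj d k (tensorWith (Nat.sub_add_cancel h) ψ (symIncl d (k - r) (tensorPower (k - r) φ))))

/-- The set `W_r` of `(k,r,d)`-almost product vectors. -/
def almostProductVectors (d k r : ℕ) (h : r ≤ k) : Set (Sym d k) :=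
  ⋃ φ : EuclideanSpace ℂ (Fin d), (almostProductSpace d k r h φ : Set (Sym d k))

/-- The mixed `(k,r,d)`-almost product states: convex combinations of the pure states `|w⟩⟨w|`, for
unit vectors `w ∈ W_r`. -/
def almostProductStates (d k r : ℕ) (h : r ≤ k) : Set (Sym d k →L[ℂ] Sym d k) :=
  convexHull ℝ {T | ∃ w ∈ almostProductVectors d k r h, ‖w‖ = 1 ∧ T = ketbra w}

end DeFinetti

end

/-!
The error estimates follow from an exact expansion, `partialTrace_eq_expansion`,

  `tr_{n → k} = ∑_{s ≤ k} q̂(n,k,k-s) Clone_{k-s → k} ∘ MP_{n → k-s}`.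

Each `Clone ∘ MP` is a channel, and a linear combination of channels has diamond norm at most the
sum of the absolute values of its coefficients. Cutting the expansion after `s = r` therefore costs
at most `ε_r`.

*The expansion.* Both sides are linear, and the symmetric power is spanned by the powers of vectors
(`span_tensorPower`), so it suffices to compare them on `|b⟩⟨b'|^{⊗ n}`, between `a'^{⊗ k}` and
`a^{⊗ k}`. For the partial trace this gives `⟨a',b⟩^k ⟨b',a⟩^k ⟨b',b⟩^(n-k)`. For the right-hand
side one needs the mixed moments of the uniform measure on the sphere (`integral_mixed_moment`).
They follow from the resolution of the identity `d[m] ∫ |φ⟩⟨φ|^{⊗ m} dφ = 1`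
(`integral_inner_tensorPower_mul`), and are coefficients of explicit polynomials, so that the series
is summed by the binomial theorem. The resolution of the identity comes from unitary invariance,
which determines the diagonal elements `⟨c^{⊗ m}, · c^{⊗ m}⟩` up to a constant, a polarization argument
(`inner_tensorPower_eq_zero_of_diagonal`), which passes to the off-diagonal ones, and the trace,
which fixes the constant.

*Norms.* Channels are used in Kraus form. The trace norm is the projective norm for decompositions
into rank-one operators (`exists_rankOne_decomposition`, `traceNorm_sum_rankOne_le`), and this
reduces the contractivity of `Φ ⊗ id` to the Cauchy-Schwarz inequality
(`diamondNorm_sum_smul_le`). The map `MP` is brought into a finite Kraus form by replacing the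
integral over the sphere with an exact cubature formula (`exists_cubature`), which exists because
the convex hull of a compact set in finite dimension is compact. The same formula exhibits
`Clone(MP(ρ))` as a finite convex combination of pure almost product states, with no closure
needed.

*The size of the coefficients.* Up to sign, the ratio of the coefficients at `s` and `s - 1` is at
most `δ`, and the leading coefficient is at most `1 / (1 - 2δ)`. The geometric series gives
`ε_r ≤ δ^(r+1) / ((1 - 2δ) (1 - δ)) ≤ δ^(r+1) / (1 - 3δ)`.
-/

noncomputable section

namespace DeFinetti

open InnerProductSpace Polynomial

/-! ### Singular values and the trace norm -/

section TraceNorm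

variable {E F G : Type*}
  [NormedAddCommGroup E] [InnerProductSpace ℂ E] [FiniteDimensional ℂ E]
  [NormedAddCommGroup F] [InnerProductSpace ℂ F] [FiniteDimensional ℂ F]
  [NormedAddCommGroup G] [InnerProductSpace ℂ G] [FiniteDimensional ℂ G]

/-- The right singular vectors of `T`: an orthonormal basis with orthogonal images under `T`, the
lengths of which are the singular values. -/
theorem exists_orthonormalBasis_singular (T : E →L[ℂ] E) :
    ∃ g : OrthonormalBasis (Fin (Module.finrank ℂ E)) ℂ E,
      (∀ i j, i ≠ j → inner ℂ (T (g i)) (T (g j)) = 0) ∧ traceNorm T = ∑ i, ‖T (g i)‖ := by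
  set A : E →ₗ[ℂ] E := (T : E →ₗ[ℂ] E)
  have hA := A.isSymmetric_adjoint_comp_self
  set g := hA.eigenvectorBasis rfl
  have hg : ∀ i j, inner ℂ (T (g i)) (T (g j)) =
      (hA.eigenvalues rfl j : ℂ) * inner ℂ (g i) (g j) := by
    intro i j
    have h1 : inner ℂ (A (g i)) (A (g j)) = inner ℂ (g i) ((A.adjoint ∘ₗ A) (g j)) := by
      rw [LinearMap.comp_apply, LinearMap.adjoint_inner_right]
    have h2 := hA.apply_eigenvectorBasis rfl j
    change inner ℂ (A (g i)) (A (g j)) = _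
    rw [h1, h2, inner_smul_right]
    rfl
  refine ⟨g, fun i j hij => ?_, ?_⟩
  · rw [hg, g.inner_eq_zero hij, mul_zero]
  · have h1 : ∀ i : Fin (Module.finrank ℂ E), A.singularValues i = ‖T (g i)‖ := by
      intro i
      rw [A.singularValues_fin rfl, norm_eq_sqrt_re_inner (𝕜 := ℂ), hg, g.inner_eq_one]
      simp
    rw [traceNorm, Finsupp.sum_of_support_subset (s := Finset.range (Module.finrank ℂ E)),
      Finset.sum_range]
    · exact Finset.sum_congr rfl fun i _ => h1 i
    · rw [A.support_singularValues]
      exact Finset.range_subset_range.2 (Submodule.finrank_le _)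
    · simp

/-- Singular value decomposition, as a decomposition into rank-one operators. -/
theorem exists_rankOne_decomposition (T : E →L[ℂ] E) :
    ∃ (N : ℕ) (u v : Fin N → E), T = ∑ i, rankOne ℂ (u i) (v i) ∧
      traceNorm T = ∑ i, ‖u i‖ * ‖v i‖ := by
  obtain ⟨g, -, h⟩ := exists_orthonormalBasis_singular T
  refine ⟨_, fun i => T (g i), g, ?_, by simp [h]⟩
  ext x
  conv_lhs => rw [← g.sum_repr' x]
  simp

theorem norm_sum_mul_le_of_sq_le {ι : Type*} (s : Finset ι) (a b : ι → ℂ) {A B : ℝ} (hA : 0 ≤ A)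
    (hB : 0 ≤ B) (ha : ∑ i ∈ s, ‖a i‖ ^ 2 ≤ A ^ 2) (hb : ∑ i ∈ s, ‖b i‖ ^ 2 ≤ B ^ 2) :
    ∑ i ∈ s, ‖a i‖ * ‖b i‖ ≤ A * B := by
  refine (Real.sum_mul_le_sqrt_mul_sqrt s _ _).trans ?_
  exact mul_le_mul (Real.sqrt_le_iff.2 ⟨hA, ha⟩) (Real.sqrt_le_iff.2 ⟨hB, hb⟩)
    (Real.sqrt_nonneg _) hA

/-- The trace norm is at most the projective norm of any decomposition into rank-one operators. -/
theorem traceNorm_sum_rankOne_le {ι : Type*} (s : Finset ι) (u v : ι → E) :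
    traceNorm (∑ j ∈ s, rankOne ℂ (u j) (v j)) ≤ ∑ j ∈ s, ‖u j‖ * ‖v j‖ := by
  classical
  set T := ∑ j ∈ s, rankOne ℂ (u j) (v j) with hT
  obtain ⟨g, horth, h⟩ := exists_orthonormalBasis_singular T
  -- the left singular vectors, for the indices with a non-zero singular value
  set S : Finset (Fin (Module.finrank ℂ E)) := {i | T (g i) ≠ 0}
  set f : S → E := fun i => ((‖T (g i)‖ : ℂ)⁻¹) • T (g i)
  have hf : Orthonormal ℂ f := by
    refine ⟨fun i => ?_, fun i j hij => ?_⟩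
    · have hi : ‖T (g i)‖ ≠ 0 := norm_ne_zero_iff.2 (Finset.mem_filter.1 i.2).2
      simp [f, norm_smul, hi]
    · simp [f, inner_smul_left, inner_smul_right, horth i j (fun h => hij (Subtype.ext h))]
  have hval : ∀ i : S, (‖T (g i)‖ : ℂ) = inner ℂ (f i) (T (g i)) := by
    intro i
    have hi : (‖T (g i)‖ : ℂ) ≠ 0 := by
      exact_mod_cast norm_ne_zero_iff.2 (Finset.mem_filter.1 i.2).2
    simp only [f, inner_smul_left, inner_self_eq_norm_sq_to_K]
    simp
    field_simp
  have hsum : traceNorm T = ∑ i : S, ‖T (g i)‖ := by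
    rw [h, Finset.sum_coe_sort S (fun i => ‖T (g i)‖), Finset.sum_filter]
    refine Finset.sum_congr rfl fun i _ => ?_
    split_ifs with hi
    · rfl
    · simpa using hi
  have hexp : (traceNorm T : ℂ) =
      ∑ j ∈ s, ∑ i : S, inner ℂ (f i) (u j) * inner ℂ (v j) (g i) := by
    rw [hsum, Finset.sum_comm]
    push_cast
    refine Finset.sum_congr rfl fun i _ => ?_
    rw [hval, hT]
    simp [mul_comm]
  have hnn : 0 ≤ traceNorm T := by rw [h]; positivity
  calc traceNorm T = ‖(traceNorm T : ℂ)‖ := by simp [abs_of_nonneg hnn]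
    _ ≤ ∑ j ∈ s, ∑ i : S, ‖inner ℂ (f i) (u j)‖ * ‖inner ℂ (v j) (g i)‖ := by
      rw [hexp]
      refine (norm_sum_le _ _).trans (Finset.sum_le_sum fun j _ => (norm_sum_le _ _).trans ?_)
      simp
    _ ≤ _ := by
      refine Finset.sum_le_sum fun j _ => ?_
      refine norm_sum_mul_le_of_sq_le _ _ _ (norm_nonneg _) (norm_nonneg _)
        (hf.sum_inner_products_le _) ?_
      have : Orthonormal ℂ fun i : S => g i := g.orthonormal.comp _ Subtype.val_injective
      simpa only [norm_inner_symm] using this.sum_inner_products_le (s := Finset.univ) (v j)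

theorem traceNorm_sum_smul_rankOne_le {ι : Type*} (s : Finset ι) (c : ι → ℂ) (u v : ι → E) :
    traceNorm (∑ j ∈ s, c j • rankOne ℂ (u j) (v j)) ≤ ∑ j ∈ s, ‖c j‖ * (‖u j‖ * ‖v j‖) := by
  have := traceNorm_sum_rankOne_le s (fun j => c j • u j) v
  simpa [norm_smul, mul_assoc] using this

end TraceNorm

/-! ### Channels and the diamond norm -/

section Channels

variable {E F G : Type*}
  [NormedAddCommGroup E] [InnerProductSpace ℂ E] [NormedAddCommGroup F] [InnerProductSpace ℂ F]
  [NormedAddCommGroup G] [InnerProductSpace ℂ G]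

/-- Quantum channels, in Kraus form: `Φ(X) = ∑ K_i X K_i†`, with finitely many operators `K_i` that
satisfy `∑ K_i† K_i = 1`. The latter condition is stated through its quadratic form, and the former
through its values at the rank-one operators `X = |x⟩⟨y|`, which span. -/
def IsChannel (Φ : (E →L[ℂ] E) →ₗ[ℂ] (F →L[ℂ] F)) : Prop :=
  ∃ (N : ℕ) (K : Fin N → E →L[ℂ] F),
    (∀ x y, Φ (rankOne ℂ x y) = ∑ i, rankOne ℂ (K i x) (K i y)) ∧
      ∀ x, ∑ i, ‖K i x‖ ^ 2 = ‖x‖ ^ 2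

theorem IsChannel.of_fintype {ι : Type*} [Fintype ι] {Φ : (E →L[ℂ] E) →ₗ[ℂ] (F →L[ℂ] F)}
    (K : ι → E →L[ℂ] F) (h : ∀ x y, Φ (rankOne ℂ x y) = ∑ i, rankOne ℂ (K i x) (K i y))
    (h' : ∀ x, ∑ i, ‖K i x‖ ^ 2 = ‖x‖ ^ 2) : IsChannel Φ := by
  let e := (Fintype.equivFin ι).symm
  refine ⟨_, K ∘ e, fun x y => ?_, fun x => ?_⟩
  · rw [h, ← e.sum_comp]
    rfl
  · rw [← h', ← e.sum_comp]
    rfl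

theorem IsChannel.comp {Φ : (E →L[ℂ] E) →ₗ[ℂ] (F →L[ℂ] F)} {Ψ : (F →L[ℂ] F) →ₗ[ℂ] (G →L[ℂ] G)}
    (hΨ : IsChannel Ψ) (hΦ : IsChannel Φ) : IsChannel (Ψ ∘ₗ Φ) := by
  obtain ⟨M, K, hK, hK'⟩ := hΦ
  obtain ⟨N, L, hL, hL'⟩ := hΨ
  refine IsChannel.of_fintype (fun p : Fin M × Fin N => L p.2 ∘L K p.1) (fun x y => ?_) fun x => ?_
  · simp [hK, hL, Fintype.sum_prod_type]
  · simp [Fintype.sum_prod_type, hK', hL']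

variable [FiniteDimensional ℂ E] [FiniteDimensional ℂ F]

/-- A state is a sum of projections onto vectors with total squared length `1`. -/
theorem IsState.exists_sum_ketbra {ρ : E →L[ℂ] E} (hρ : IsState ρ) :
    ∃ (N : ℕ) (u : Fin N → E), ρ = ∑ i, ketbra (u i) ∧ ∑ i, ‖u i‖ ^ 2 = 1 := by
  obtain ⟨N, u, rfl⟩ := ContinuousLinearMap.isPositive_iff_eq_sum_rankOne.1 hρ.1
  refine ⟨N, u, rfl, ?_⟩
  have h := hρ.2
  simp only [ContinuousLinearMap.toLinearMap_sum, map_sum, trace_rankOne,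
    inner_self_eq_norm_sq_to_K] at h
  exact Complex.ofReal_injective (by simpa using h)

theorem isState_sum_ketbra {N : ℕ} (u : Fin N → E) (h : ∑ i, ‖u i‖ ^ 2 = 1) :
    IsState (∑ i, ketbra (u i)) := by
  refine ⟨ContinuousLinearMap.isPositive_iff_eq_sum_rankOne.2 ⟨N, u, rfl⟩, ?_⟩
  simp only [ketbra, ContinuousLinearMap.toLinearMap_sum, map_sum, trace_rankOne,
    inner_self_eq_norm_sq_to_K]
  simpa using congrArg Complex.ofReal h

theorem IsChannel.isState {Φ : (E →L[ℂ] E) →ₗ[ℂ] (F →L[ℂ] F)} (hΦ : IsChannel Φ) {ρ : E →L[ℂ] E}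
    (hρ : IsState ρ) : IsState (Φ ρ) := by
  obtain ⟨N, u, rfl, hu⟩ := hρ.exists_sum_ketbra
  obtain ⟨M, K, hK, hK'⟩ := hΦ
  let e := (Fintype.equivFin (Fin N × Fin M)).symm
  have h1 : Φ (∑ i, ketbra (u i)) = ∑ p, ketbra (K (e p).2 (u (e p).1)) := by
    rw [e.sum_comp (fun p => ketbra (K p.2 (u p.1))), Fintype.sum_prod_type]
    simp [ketbra, hK]
  rw [h1]
  refine isState_sum_ketbra _ ?_
  rw [e.sum_comp (fun p => ‖K p.2 (u p.1)‖ ^ 2), Fintype.sum_prod_type]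
  simp [hK', hu]

theorem traceNorm_sum_smul_state_le {ι : Type*} (s : Finset ι) (c : ι → ℂ)
    {ρ : ι → E →L[ℂ] E} (hρ : ∀ i ∈ s, IsState (ρ i)) :
    traceNorm (∑ i ∈ s, c i • ρ i) ≤ ∑ i ∈ s, ‖c i‖ := by
  have h : ∀ i : ι, ∃ (N : ℕ) (u : Fin N → E), i ∈ s →
      ρ i = ∑ l, ketbra (u l) ∧ ∑ l, ‖u l‖ ^ 2 = 1 := by
    intro i
    by_cases hi : i ∈ s
    · obtain ⟨N, u, hu⟩ := (hρ i hi).exists_sum_ketbra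
      exact ⟨N, u, fun _ => hu⟩
    · exact ⟨0, fun _ => 0, fun h => absurd h hi⟩
  choose N u hu using h
  have h1 : ∑ i ∈ s, c i • ρ i =
      ∑ p ∈ s.sigma fun i => (Finset.univ : Finset (Fin (N i))),
        c p.1 • rankOne ℂ (u p.1 p.2) (u p.1 p.2) := by
    rw [Finset.sum_sigma]
    refine Finset.sum_congr rfl fun i hi => ?_
    rw [(hu i hi).1, Finset.smul_sum]
    rfl
  rw [h1]
  refine (traceNorm_sum_smul_rankOne_le _ _ _ _).trans_eq ?_
  rw [Finset.sum_sigma]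
  refine Finset.sum_congr rfl fun i hi => ?_
  dsimp only
  rw [← Finset.mul_sum]
  simp only [← sq, (hu i hi).2, mul_one]

theorem blockOperator_apply {D : ℕ} (X : Fin D → Fin D → (E →L[ℂ] E))
    (v : PiLp 2 fun _ : Fin D => E) (i : Fin D) : blockOperator X v i = ∑ j, X i j (v j) := rfl

theorem blockOperator_injective {D : ℕ} :
    Function.Injective (blockOperator (E := E) (D := D)) := by
  intro X Y h
  ext i j x
  have := congrArg (fun T => T (PiLp.single 2 j x) i) h
  simpa [blockOperator_apply, Pi.single_apply, apply_ite] using this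

theorem rankOne_eq_blockOperator {D : ℕ} (u v : PiLp 2 fun _ : Fin D => E) :
    rankOne ℂ u v = blockOperator fun i j => rankOne ℂ (u i) (v j) := by
  ext x i
  simp [blockOperator_apply, PiLp.inner_apply, Finset.sum_smul]

theorem blockOperator_sum {ι : Type*} (s : Finset ι) {D : ℕ}
    (c : ι → ℂ) (X : ι → Fin D → Fin D → (E →L[ℂ] E)) :
    (blockOperator fun i j => ∑ l ∈ s, c l • X l i j) = ∑ l ∈ s, c l • blockOperator (X l) := by
  ext x i
  simp only [blockOperator_apply, _root_.sum_apply, _root_.smul_apply, WithLp.ofLp_sum,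
    Finset.sum_apply, PiLp.smul_apply, Finset.smul_sum]
  exact Finset.sum_comm

/-- A linear combination of channels has diamond norm at most the sum of the absolute values of the
coefficients. After a singular value decomposition of the argument it is enough to treat
`|u⟩⟨v|`, and `K_i ⊗ 1` sends this to `|K_i u⟩⟨K_i v|`; the products `‖K_i u‖ ‖K_i v‖` have
sum at most `‖u‖ ‖v‖`. -/
theorem diamondNorm_sum_smul_le {ι : Type*} (s : Finset ι) (c : ι → ℂ)
    {Φ : ι → (E →L[ℂ] E) →ₗ[ℂ] (F →L[ℂ] F)} (hΦ : ∀ i ∈ s, IsChannel (Φ i)) :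
    diamondNorm (∑ i ∈ s, c i • Φ i) ≤ ENNReal.ofReal (∑ i ∈ s, ‖c i‖) := by
  have h : ∀ i : ι, ∃ (N : ℕ) (K : Fin N → E →L[ℂ] F), i ∈ s →
      (∀ x y, Φ i (rankOne ℂ x y) = ∑ l, rankOne ℂ (K l x) (K l y)) ∧
      ∀ x, ∑ l, ‖K l x‖ ^ 2 = ‖x‖ ^ 2 := by
    intro i
    by_cases hi : i ∈ s
    · obtain ⟨N, K, hK⟩ := hΦ i hi
      exact ⟨N, K, fun _ => hK⟩
    · exact ⟨0, fun _ => 0, fun h => absurd h hi⟩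
  choose N K hK using h
  refine iSup_le fun D => iSup_le fun X => iSup_le fun hX => ENNReal.ofReal_le_ofReal ?_
  obtain ⟨M, u, v, huv, hnorm⟩ := exists_rankOne_decomposition (blockOperator X)
  have hX' : X = fun i j => ∑ l, (1 : ℂ) • rankOne ℂ (u l i) (v l j) := by
    refine blockOperator_injective ?_
    rw [blockOperator_sum, huv]
    simp [rankOne_eq_blockOperator]
  -- the Kraus operators `K ⊗ 1`
  let K' : (i : ι) → Fin (N i) → (PiLp 2 fun _ : Fin D => E) → PiLp 2 fun _ : Fin D => F :=
    fun i κ x => WithLp.toLp 2 fun j => K i κ (x j)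
  have hK' : ∀ i ∈ s, ∀ x, ∑ κ, ‖K' i κ x‖ ^ 2 = ‖x‖ ^ 2 := by
    intro i hi x
    simp only [PiLp.norm_sq_eq_of_L2, K']
    rw [Finset.sum_comm]
    exact Finset.sum_congr rfl fun j _ => (hK i hi).2 _
  have h1 : (blockOperator fun a b => (∑ i ∈ s, c i • Φ i) (X a b)) =
      ∑ p ∈ s.sigma fun i => (Finset.univ : Finset (Fin M × Fin (N i))),
        c p.1 • rankOne ℂ (K' p.1 p.2.2 (u p.2.1)) (K' p.1 p.2.2 (v p.2.1)) := by
    simp only [rankOne_eq_blockOperator]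
    rw [← blockOperator_sum]
    congr 1
    ext a b : 2
    rw [hX', Finset.sum_sigma, LinearMap.sum_apply]
    refine Finset.sum_congr rfl fun i hi => ?_
    dsimp only
    rw [LinearMap.smul_apply, Fintype.sum_prod_type]
    simp only [one_smul, map_sum, (hK i hi).1, Finset.smul_sum]
    rfl
  rw [h1]
  refine (traceNorm_sum_smul_rankOne_le _ _ _ _).trans ?_
  rw [Finset.sum_sigma]
  refine Finset.sum_le_sum fun i hi => ?_
  dsimp only
  rw [← Finset.mul_sum, Fintype.sum_prod_type]
  refine mul_le_of_le_one_right (norm_nonneg _) ?_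
  refine le_trans (Finset.sum_le_sum fun l _ => ?_) (hnorm ▸ hX)
  refine (Real.sum_mul_le_sqrt_mul_sqrt _ _ _).trans_eq ?_
  dsimp only
  rw [hK' i hi, hK' i hi, Real.sqrt_sq (norm_nonneg _), Real.sqrt_sq (norm_nonneg _)]

end Channels

/-! ### The symmetric power -/

section SymmetricPowers

variable {d : ℕ}

theorem inner_sym {n : ℕ} (u v : Sym d n) :
    inner ℂ u v = inner ℂ (symIncl d n u) (symIncl d n v) := rfl

theorem inner_symProj_left {n : ℕ} (t : TensorSpace d n) (u : Sym d n) :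
    inner ℂ (symProj d n t) u = inner ℂ t (symIncl d n u) :=
  Submodule.inner_orthogonalProjectionOnto_eq_of_mem_right _ _

theorem inner_symProj_right {n : ℕ} (t : TensorSpace d n) (u : Sym d n) :
    inner ℂ u (symProj d n t) = inner ℂ (symIncl d n u) t :=
  Submodule.inner_orthogonalProjectionOnto_eq_of_mem_left _ _

theorem symProj_symIncl {n : ℕ} (u : Sym d n) : symProj d n (symIncl d n u) = u :=
  Submodule.orthogonalProjectionOnto_mem_subspace_eq_self (K := symSubspace d n) u

theorem symIncl_comp_perm {n : ℕ} (u : Sym d n) (σ : Equiv.Perm (Fin n)) (f : Fin n → Fin d) :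
    symIncl d n u (f ∘ σ) = symIncl d n u f := u.2 σ f

theorem symIncl_tensorPower_apply {n : ℕ} (x : EuclideanSpace ℂ (Fin d)) (f : Fin n → Fin d) :
    symIncl d n (tensorPower n x) f = ∏ i, x (f i) := rfl

theorem inner_tensorPower {n : ℕ} (x y : EuclideanSpace ℂ (Fin d)) :
    inner ℂ (tensorPower n x) (tensorPower n y) = inner ℂ x y ^ n := by
  rw [inner_sym, PiLp.inner_apply, PiLp.inner_apply, Fintype.sum_pow]
  refine Finset.sum_congr rfl fun f _ => ?_
  simp [symIncl_tensorPower_apply, Finset.prod_mul_distrib]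

theorem norm_tensorPower {n : ℕ} (x : EuclideanSpace ℂ (Fin d)) :
    ‖tensorPower n x‖ = ‖x‖ ^ n := by
  have h := inner_tensorPower (n := n) x x
  rw [inner_self_eq_norm_sq_to_K, inner_self_eq_norm_sq_to_K, ← pow_mul, mul_comm, pow_mul] at h
  have h' : ‖tensorPower n x‖ ^ 2 = (‖x‖ ^ n) ^ 2 := Complex.ofReal_injective (by simpa using h)
  exact (sq_eq_sq₀ (norm_nonneg _) (by positivity)).1 h'

theorem inner_tensorPower_tensorWith {a b n : ℕ} (h : a + b = n) (c : EuclideanSpace ℂ (Fin d))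
    (u : TensorSpace d a) (v : TensorSpace d b) :
    inner ℂ (symIncl d n (tensorPower n c)) (tensorWith h v u) =
      inner ℂ (symIncl d a (tensorPower a c)) u * inner ℂ (symIncl d b (tensorPower b c)) v := by
  subst h
  simp only [PiLp.inner_apply, Finset.sum_mul_sum, symIncl_tensorPower_apply]
  rw [← Fintype.sum_prod_type', ← (Fin.appendEquiv a b).sum_comp]
  refine Finset.sum_congr rfl fun p _ => ?_
  simp [tensorWith, Fin.appendEquiv, Fin.prod_univ_add]
  ring

/-- The multiset of the letters of a word. -/
def letters {n : ℕ} (f : Fin n → Fin d) : _root_.Sym (Fin d) n :=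
  ⟨Multiset.map f Finset.univ.val, by simp⟩

theorem letters_surjective (n : ℕ) : Function.Surjective (letters (d := d) (n := n)) := by
  rintro ⟨s, hs⟩
  induction s using Quotient.inductionOn with
  | h l =>
    have hl : l.length = n := hs
    subst hl
    refine ⟨l.get, Subtype.ext ?_⟩
    change Multiset.map l.get Finset.univ.val = _
    rw [Fin.univ_val_map, List.ofFn_get]
    rfl

theorem letters_comp_perm {n : ℕ} (f : Fin n → Fin d) (σ : Equiv.Perm (Fin n)) :
    letters (f ∘ σ) = letters f := by
  refine Subtype.ext ?_
  change Multiset.map (f ∘ σ) Finset.univ.val = Multiset.map f Finset.univ.val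
  rw [← Multiset.map_map, Multiset.map_univ_val_equiv]

theorem exists_perm_of_letters_eq {n : ℕ} (f g : Fin n → Fin d) (h : letters f = letters g) :
    ∃ σ : Equiv.Perm (Fin n), g ∘ σ = f := by
  have h1 : ∀ c, Nonempty ({i // f i = c} ≃ {i // g i = c}) := by
    intro c
    refine Fintype.card_eq.1 ?_
    have h2 := congrArg (fun s : _root_.Sym (Fin d) n => s.1.count c) h
    simp only [letters, Multiset.count_map] at h2
    simpa [Fintype.card_subtype, Finset.card_def, eq_comm] using h2
  exact ⟨Equiv.ofFiberEquiv fun c => (h1 c).some, funext fun i => Equiv.ofFiberEquiv_map _ i⟩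

theorem symIncl_eq_of_letters_eq {n : ℕ} (v : Sym d n) {f g : Fin n → Fin d}
    (h : letters f = letters g) : symIncl d n v f = symIncl d n v g := by
  obtain ⟨σ, rfl⟩ := exists_perm_of_letters_eq f g h
  exact symIncl_comp_perm v σ g

/-- The symmetric power is spanned by the powers of vectors: a symmetric tensor that is orthogonal
to all of them is given by a homogeneous polynomial that vanishes everywhere. -/
theorem span_tensorPower (n : ℕ) :
    Submodule.span ℂ (Set.range (tensorPower (d := d) n)) = ⊤ := by
  classical
  rw [← Submodule.orthogonal_eq_bot_iff, Submodule.eq_bot_iff]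
  intro v hv
  let w : (Fin n → Fin d) → ℂ := fun f => symIncl d n v f
  let ty : (Fin n → Fin d) → (Fin d →₀ ℕ) := fun f =>
    Multiset.toFinsupp (letters f).1
  let p : MvPolynomial (Fin d) ℂ := ∑ f, MvPolynomial.monomial (ty f) (w f)
  have hp : p = 0 := by
    refine MvPolynomial.funext fun x => ?_
    have h1 : inner ℂ (tensorPower n (WithLp.toLp 2 fun i => (starRingEnd ℂ) (x i))) v = 0 :=
      hv _ (Submodule.subset_span ⟨_, rfl⟩)
    rw [inner_sym, PiLp.inner_apply] at h1
    rw [map_zero, ← h1, map_sum]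
    refine Finset.sum_congr rfl fun f _ => ?_
    rw [MvPolynomial.eval_monomial]
    have h2 : ((ty f).prod fun i e => x i ^ e) = ∏ i, x (f i) := by
      rw [Finsupp.prod, Multiset.toFinsupp_support]
      simp only [ty, Multiset.toFinsupp_apply]
      rw [← Finset.prod_multiset_map_count, letters, Multiset.map_map]
      rfl
    rw [h2]
    simp [symIncl_tensorPower_apply, w, map_prod]
  have hty : ∀ f g, ty f = ty g → w f = w g := fun f g hfg =>
    symIncl_eq_of_letters_eq v (Subtype.ext (Multiset.toFinsupp.injective hfg))
  have hw : ∀ f, w f = 0 := by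
    intro f
    have h3 := congrArg (MvPolynomial.coeff (ty f)) hp
    simp only [p, MvPolynomial.coeff_sum, MvPolynomial.coeff_monomial,
      MvPolynomial.coeff_zero] at h3
    have h4 : ∀ g, (if ty g = ty f then w g else 0) = if ty g = ty f then w f else 0 := by
      intro g
      split_ifs with h
      · exact hty g f h
      · rfl
    simp only [h4] at h3
    rw [← Finset.sum_filter, Finset.sum_const, nsmul_eq_mul, mul_eq_zero] at h3
    refine h3.resolve_left (Nat.cast_ne_zero.2 (Finset.card_ne_zero.2 ⟨f, by simp⟩))
  refine Subtype.ext ?_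
  ext f
  exact hw f

theorem eq_of_inner_tensorPower {n : ℕ} {T T' : Sym d n →L[ℂ] Sym d n}
    (h : ∀ a' a, inner ℂ (tensorPower n a') (T (tensorPower n a)) =
      inner ℂ (tensorPower n a') (T' (tensorPower n a))) : T = T' := by
  have h1 : ∀ a, T (tensorPower n a) = T' (tensorPower n a) := by
    intro a
    refine ext_inner_left ℂ fun u => ?_
    have hu : u ∈ Submodule.span ℂ (Set.range (tensorPower (d := d) n)) := by
      rw [span_tensorPower]
      trivial
    induction hu using Submodule.span_induction with
    | mem x hx =>
      obtain ⟨a', rfl⟩ := hx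
      exact h a' a
    | zero => simp
    | add x y _ _ hx hy => rw [inner_add_left, inner_add_left, hx, hy]
    | smul c x _ hx => rw [inner_smul_left, inner_smul_left, hx]
  refine ContinuousLinearMap.coe_injective (LinearMap.ext_on_range (span_tensorPower n) h1)

theorem finrank_sym (d n : ℕ) : Module.finrank ℂ (Sym d n) = symDim d n := by
  -- symmetric tensors are the functions on multisets of letters
  let L : (_root_.Sym (Fin d) n → ℂ) →ₗ[ℂ] Sym d n :=
    { toFun := fun φ => ⟨WithLp.toLp 2 fun f => φ (letters f), fun σ f => by
        simp [letters_comp_perm]⟩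
      map_add' := fun φ ψ => rfl
      map_smul' := fun c φ => rfl }
  have hL : ∀ φ f, symIncl d n (L φ) f = φ (letters f) := fun φ f => rfl
  have hbij : Function.Bijective L := by
    refine ⟨fun φ ψ h => funext fun s => ?_, fun v => ?_⟩
    · obtain ⟨f, rfl⟩ := letters_surjective n s
      rw [← hL φ, ← hL ψ, h]
    · refine ⟨fun s => symIncl d n v (Function.surjInv (letters_surjective n) s),
        Subtype.ext ?_⟩
      ext f
      exact symIncl_eq_of_letters_eq v (Function.surjInv_eq (letters_surjective n) _)
  rw [← (LinearEquiv.ofBijective L hbij).finrank_eq, Module.finrank_fintype_fun_eq_card,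
    Sym.card_sym_eq_choose, Fintype.card_fin, symDim]

end SymmetricPowers

/-! ### The uniform measure on the sphere and the resolution of the identity -/

section Sphere

variable {d : ℕ}

theorem isProbabilityMeasure_sphereMeasure (hd : 1 ≤ d) :
    IsProbabilityMeasure (sphereMeasure d) := by
  have : Nonempty (Fin d) := ⟨⟨0, hd⟩⟩
  constructor
  rw [sphereMeasure, Measure.smul_apply, smul_eq_mul]
  exact ENNReal.inv_mul_cancel (Measure.measure_univ_ne_zero.2 (Measure.toSphere_ne_zero _))
    (measure_ne_top _ _)

theorem measurePreserving_addHaar (e : EuclideanSpace ℂ (Fin d) ≃ₗᵢ[ℂ] EuclideanSpace ℂ (Fin d)) :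
    MeasurePreserving e (Measure.addHaar : Measure (EuclideanSpace ℂ (Fin d))) Measure.addHaar := by
  refine ⟨e.continuous.measurable, ?_⟩
  set μ : Measure (EuclideanSpace ℂ (Fin d)) := Measure.addHaar
  have : (μ.map e).IsAddHaarMeasure :=
    AddEquiv.isAddHaarMeasure_map μ e.toLinearEquiv.toAddEquiv e.continuous e.symm.continuous
  have h := Measure.isAddLeftInvariant_eq_smul (μ.map e) μ
  -- the scalar is determined by the unit ball, which is invariant
  have hball : μ.map e (Metric.ball 0 1) = μ (Metric.ball 0 1) := by
    rw [Measure.map_apply e.continuous.measurable measurableSet_ball]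
    congr 1
    simp
  have hne : μ (Metric.ball 0 1) ≠ 0 := (Metric.measure_ball_pos μ 0 one_pos).ne'
  have htop : μ (Metric.ball 0 1) ≠ ⊤ := measure_ball_lt_top.ne
  rw [h, Measure.smul_apply, ENNReal.smul_def, smul_eq_mul] at hball
  have h1 : (Measure.addHaarScalarFactor (μ.map e) μ : ENNReal) = 1 :=
    (ENNReal.mul_left_inj hne htop).1 (hball.trans (one_mul _).symm)
  rw [h, ENNReal.coe_eq_one.1 h1, one_smul]

/-- The action of a unitary on the unit sphere. -/
def sphereMap (e : EuclideanSpace ℂ (Fin d) ≃ₗᵢ[ℂ] EuclideanSpace ℂ (Fin d)) :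
    CSphere d ≃ₜ CSphere d where
  toFun x := ⟨e x.1, by simp⟩
  invFun x := ⟨e.symm x.1, by simp⟩
  left_inv x := by simp
  right_inv x := by simp
  continuous_toFun := by fun_prop
  continuous_invFun := by fun_prop

open scoped Pointwise in
theorem measurePreserving_sphereMap
    (e : EuclideanSpace ℂ (Fin d) ≃ₗᵢ[ℂ] EuclideanSpace ℂ (Fin d)) :
    MeasurePreserving (sphereMap e) (sphereMeasure d) (sphereMeasure d) := by
  refine MeasurePreserving.smul_measure ⟨(sphereMap e).continuous.measurable, ?_⟩ _
  ext s hs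
  rw [Measure.map_apply (sphereMap e).continuous.measurable hs,
    Measure.toSphere_apply' _ hs,
    Measure.toSphere_apply' _ ((sphereMap e).continuous.measurable hs)]
  congr 1
  rw [← (measurePreserving_addHaar e).measure_preimage_equiv
    (f := e.toHomeomorph.toMeasurableEquiv) (Set.Ioo (0 : ℝ) 1 • (Subtype.val '' s))]
  congr 1
  ext x
  simp only [Set.mem_smul, Set.mem_preimage]
  constructor
  · rintro ⟨t, ht, _, ⟨y, hy, rfl⟩, rfl⟩
    exact ⟨t, ht, _, ⟨_, hy, rfl⟩, (e.toLinearEquiv.map_smul_of_tower t _).symm⟩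
  · rintro ⟨t, ht, _, ⟨y, hy, rfl⟩, h⟩
    refine ⟨t, ht, _, ⟨(sphereMap e).symm y, by simpa using hy, rfl⟩, ?_⟩
    refine e.injective (Eq.trans ?_ h)
    refine (e.toLinearEquiv.map_smul_of_tower t _).trans ?_
    simp [sphereMap]

theorem exists_isometry_map_eq (hd : 1 ≤ d) {x y : EuclideanSpace ℂ (Fin d)} (hx : ‖x‖ = 1)
    (hy : ‖y‖ = 1) : ∃ e : EuclideanSpace ℂ (Fin d) ≃ₗᵢ[ℂ] EuclideanSpace ℂ (Fin d), e x = y := by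
  have h : ∀ z : EuclideanSpace ℂ (Fin d), ‖z‖ = 1 →
      ∃ b : OrthonormalBasis (Fin d) ℂ (EuclideanSpace ℂ (Fin d)), b ⟨0, hd⟩ = z := by
    intro z hz
    obtain ⟨b, hb⟩ := Orthonormal.exists_orthonormalBasis_extension_of_card_eq (𝕜 := ℂ)
      (E := EuclideanSpace ℂ (Fin d)) (ι := Fin d) (by simp) (v := fun _ => z) (s := {⟨0, hd⟩})
      ⟨fun _ => hz, fun i j hij => absurd (Subsingleton.elim i j) hij⟩
    exact ⟨b, hb _ rfl⟩
  obtain ⟨b, rfl⟩ := h x hx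
  obtain ⟨b', rfl⟩ := h y hy
  exact ⟨b.equiv b' (Equiv.refl _), by simp⟩

/-- The moments of the uniform measure on the sphere in a given direction depend on the length of
that direction only. -/
theorem exists_moment (hd : 1 ≤ d) (m : ℕ) : ∃ C : ℂ, ∀ c : EuclideanSpace ℂ (Fin d),
    ∫ x : CSphere d, inner ℂ c x.1 ^ m * inner ℂ x.1 c ^ m ∂(sphereMeasure d) =
      C * inner ℂ c c ^ m := by
  let I : EuclideanSpace ℂ (Fin d) → ℂ := fun c =>
    ∫ x : CSphere d, inner ℂ c x.1 ^ m * inner ℂ x.1 c ^ m ∂(sphereMeasure d)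
  have hinv : ∀ (e : EuclideanSpace ℂ (Fin d) ≃ₗᵢ[ℂ] EuclideanSpace ℂ (Fin d)) c,
      I (e c) = I c := by
    intro e c
    have h := (measurePreserving_sphereMap e).integral_comp
      (sphereMap e).measurableEmbedding fun x : CSphere d =>
        inner ℂ (e c) x.1 ^ m * inner ℂ x.1 (e c) ^ m
    refine h.symm.trans ?_
    simp [sphereMap, I]
  have hsmul : ∀ (a : ℂ) c, I (a • c) = ((starRingEnd ℂ) a * a) ^ m * I c := by
    intro a c
    simp only [I]
    rw [← integral_const_mul]
    refine integral_congr_ae (Filter.Eventually.of_forall fun x => ?_)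
    simp only [inner_smul_left, inner_smul_right]
    ring
  let x₀ : EuclideanSpace ℂ (Fin d) := EuclideanSpace.single ⟨0, hd⟩ 1
  have hx₀ : ‖x₀‖ = 1 := by simp [x₀]
  refine ⟨I x₀, fun c => ?_⟩
  change I c = _
  obtain ⟨y, hy, hc⟩ : ∃ y : EuclideanSpace ℂ (Fin d), ‖y‖ = 1 ∧ c = (‖c‖ : ℂ) • y := by
    by_cases h0 : c = 0
    · exact ⟨x₀, hx₀, by simp [h0]⟩
    · refine ⟨(‖c‖ : ℂ)⁻¹ • c, ?_, ?_⟩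
      · simp [norm_smul, h0]
      · rw [smul_smul, mul_inv_cancel₀ (by simpa using h0), one_smul]
  obtain ⟨e, he⟩ := exists_isometry_map_eq hd hx₀ hy
  conv_lhs => rw [hc, hsmul, ← he, hinv]
  rw [inner_self_eq_norm_sq_to_K, mul_comm]
  simp [sq]

/-- Polarization: an operator on tensors is determined, on the powers of vectors, by its diagonal
matrix elements. The off-diagonal element between `a'` and `a` is the constant coefficient of the
polynomial `⟨(z̄ a + a')^{⊗ m}, T (a + z a')^{⊗ m}⟩`, which for `|z| = 1` is a multiple of the
diagonal element at `a + z a'`. -/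
theorem inner_tensorPower_eq_zero_of_diagonal {m : ℕ} (T : Sym d m →L[ℂ] Sym d m)
    (hT : ∀ c, inner ℂ (tensorPower m c) (T (tensorPower m c)) = 0)
    (a' a : EuclideanSpace ℂ (Fin d)) :
    inner ℂ (tensorPower m a') (T (tensorPower m a)) = 0 := by
  let t : (Fin m → Fin d) → (Fin m → Fin d) → ℂ := fun f g =>
    symIncl d m (T (symProj d m (basisTensor g))) f
  have ht : ∀ x y : EuclideanSpace ℂ (Fin d), inner ℂ (tensorPower m x) (T (tensorPower m y)) =
      ∑ f, ∑ g, (∏ i, (starRingEnd ℂ) (x (f i))) * (∏ i, y (g i)) * t f g := by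
    intro x y
    have h1 : tensorPower m y =
        ∑ g : Fin m → Fin d, (∏ i, y (g i)) • symProj d m (basisTensor g) := by
      rw [← symProj_symIncl (tensorPower m y)]
      simp_rw [← map_smul, ← map_sum]
      congr 1
      ext f
      simp [symIncl_tensorPower_apply, basisTensor, Pi.single_apply]
    rw [h1, inner_sym, PiLp.inner_apply]
    refine Finset.sum_congr rfl fun f _ => ?_
    simp only [map_sum, map_smul, RCLike.inner_apply, WithLp.ofLp_sum, Finset.sum_apply,
      PiLp.smul_apply, smul_eq_mul, symIncl_tensorPower_apply, Finset.sum_mul, map_prod, t]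
    refine Finset.sum_congr rfl fun g _ => ?_
    ring
  let P : ℂ[X] := ∑ f, ∑ g,
    (∏ i, (X * C ((starRingEnd ℂ) (a (f i))) + C ((starRingEnd ℂ) (a' (f i))))) *
      (∏ i, (C (a (g i)) + X * C (a' (g i)))) * C (t f g)
  have hP : ∀ z : ℂ, P.eval z =
      inner ℂ (tensorPower m ((starRingEnd ℂ) z • a + a')) (T (tensorPower m (a + z • a'))) := by
    intro z
    rw [ht]
    simp [P, Polynomial.eval_finsetSum, Polynomial.eval_prod, mul_comm z]
  have hpow : ∀ (w : ℂ) (x : EuclideanSpace ℂ (Fin d)),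
      tensorPower m (w • x) = w ^ m • tensorPower m x := by
    intro w x
    refine Subtype.ext ?_
    ext f
    change ∏ i, (w • x) (f i) = w ^ m * ∏ i, x (f i)
    simp [Finset.prod_mul_distrib]
  have hP0 : P = 0 := by
    refine Polynomial.eq_zero_of_infinite_isRoot P
      (Set.Infinite.mono (s := Metric.sphere 0 1) ?_ ?_)
    · intro z hz
      have hz1 : z * (starRingEnd ℂ) z = 1 := by
        have : ‖z‖ = 1 := by simpa using hz
        simp [Complex.mul_conj', this]
      have h2 : (starRingEnd ℂ) z • a + a' = (starRingEnd ℂ) z • (a + z • a') := by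
        rw [smul_add, smul_smul, mul_comm, hz1, one_smul]
      change P.eval z = 0
      rw [hP, h2, hpow, inner_smul_left, hT, mul_zero]
    · refine (isPreconnected_sphere (E := ℂ) ?_ 0 1).infinite_of_nontrivial ?_
      · rw [Complex.rank_real_complex]
        norm_num
      · exact ⟨1, by simp, -1, by simp, by norm_num⟩
  have h3 := hP 0
  rw [hP0] at h3
  simpa using h3.symm

theorem continuous_ketbra_tensorPower (d m : ℕ) :
    Continuous fun x : CSphere d => ketbra (tensorPower m x.1) := by
  have hcont := continuous_tensorPower d m
  refine (continuous_clm_apply (𝕜 := ℂ)).2 fun v => ?_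
  simp only [ketbra, rankOne_apply]
  fun_prop

theorem inner_integral_ketbra_tensorPower {m : ℕ} (u v : Sym d m) :
    inner ℂ u ((∫ x : CSphere d, ketbra (tensorPower m x.1) ∂(sphereMeasure d)) v) =
      ∫ x : CSphere d, inner ℂ u (tensorPower m x.1) * inner ℂ (tensorPower m x.1) v
        ∂(sphereMeasure d) := by
  rcases Nat.eq_zero_or_pos d with rfl | hd
  · have : IsEmpty (CSphere 0) := ⟨fun x => by simpa [Subsingleton.elim x.1 0] using x.2⟩
    simp [Measure.eq_zero_of_isEmpty]
  have := isProbabilityMeasure_sphereMeasure hd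
  have hint : Integrable (fun x : CSphere d => ketbra (tensorPower m x.1)) (sphereMeasure d) :=
    (continuous_ketbra_tensorPower d m).integrable_of_hasCompactSupport
      (HasCompactSupport.of_compactSpace _)
  rw [← ContinuousLinearMap.apply_apply v (∫ _, _ ∂_),
    ← ContinuousLinearMap.integral_comp_comm _ hint, ← integral_inner]
  · simp [ketbra, inner_smul_right, mul_comm]
  · exact ContinuousLinearMap.integrable_comp _ hint

/-- Resolution of the identity: `d[m] ∫ |φ⟩⟨φ|^{⊗ m} dφ = 1` on the symmetric power. -/
theorem integral_inner_tensorPower_mul (hd : 1 ≤ d) (m : ℕ) (u v : Sym d m) :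
    ∫ x : CSphere d, inner ℂ u (tensorPower m x.1) * inner ℂ (tensorPower m x.1) v
      ∂(sphereMeasure d) = (symDim d m : ℂ)⁻¹ * inner ℂ u v := by
  have := isProbabilityMeasure_sphereMeasure hd
  obtain ⟨C, hC⟩ := exists_moment hd m
  have hcont := continuous_tensorPower d m
  set M : Sym d m →L[ℂ] Sym d m := ∫ x : CSphere d, ketbra (tensorPower m x.1) ∂(sphereMeasure d)
  have hM : ∀ u v, ∫ x : CSphere d, inner ℂ u (tensorPower m x.1) * inner ℂ (tensorPower m x.1) v
      ∂(sphereMeasure d) = inner ℂ u (M v) :=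
    fun u v => (inner_integral_ketbra_tensorPower u v).symm
  have hdiag : ∀ c, inner ℂ (tensorPower m c) ((M - C • ContinuousLinearMap.id ℂ (Sym d m))
      (tensorPower m c)) = 0 := by
    intro c
    rw [sub_apply, inner_sub_right, ← hM]
    simp only [inner_tensorPower, smul_apply, inner_smul_right, hC]
    simp [norm_tensorPower, ← pow_mul, mul_comm m]
  have hMC : M = C • ContinuousLinearMap.id ℂ _ := by
    refine eq_of_inner_tensorPower fun a' a => sub_eq_zero.1 ?_
    rw [← inner_sub_right]
    exact inner_tensorPower_eq_zero_of_diagonal _ hdiag a' a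
  have htr : C * symDim d m = 1 := by
    have h1 : LinearMap.trace ℂ _ (M : Sym d m →ₗ[ℂ] Sym d m) = C * symDim d m := by
      rw [hMC, ContinuousLinearMap.toLinearMap_smul, map_smul, ContinuousLinearMap.coe_id,
        LinearMap.trace_id, finrank_sym, smul_eq_mul]
    rw [← h1, LinearMap.trace_eq_sum_inner _ (stdOrthonormalBasis ℂ (Sym d m))]
    simp only [ContinuousLinearMap.coe_coe, ← hM]
    rw [← integral_finsetSum]
    · simp only [mul_comm (inner ℂ (stdOrthonormalBasis ℂ (Sym d m) _) _),
        OrthonormalBasis.sum_inner_mul_inner]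
      simp [norm_tensorPower]
    · intro i _
      refine Continuous.integrable_of_hasCompactSupport ?_ (HasCompactSupport.of_compactSpace _)
      fun_prop
  rw [hM, hMC, eq_inv_of_mul_eq_one_left htr]
  simp

end Sphere

/-! ### Convex hulls of compact sets and cubature -/

section Cubature

variable {V : Type*} [NormedAddCommGroup V] [NormedSpace ℝ V] [FiniteDimensional ℝ V]

/-- In finite dimension, the convex hull of a compact set is compact, by Carathéodory's theorem. -/
theorem isCompact_convexHull_of_finiteDimensional {s : Set V} (hs : IsCompact s) :
    IsCompact (convexHull ℝ s) := by
  classical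
  rcases s.eq_empty_or_nonempty with rfl | ⟨x₀, hx₀⟩
  · simp
  set N := Module.finrank ℝ V + 1
  let F : (Fin N → ℝ) × (Fin N → V) → V := fun p => ∑ i, p.1 i • p.2 i
  have hF : Continuous F := by fun_prop
  have hK : IsCompact (stdSimplex ℝ (Fin N) ×ˢ Set.univ.pi fun _ : Fin N => s) :=
    (isCompact_stdSimplex ℝ (Fin N)).prod (isCompact_univ_pi fun _ => hs)
  convert hK.image hF using 1
  refine Set.Subset.antisymm (fun x hx => ?_) ?_
  · obtain ⟨ι, _, z, w, hz, hind, hw, hw1, rfl⟩ := eq_pos_convex_span_of_mem_convexHull hx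
    have hcard : Fintype.card ι ≤ Fintype.card (Fin N) := by
      rw [Fintype.card_fin]
      exact hind.card_le_finrank_succ.trans (Nat.succ_le_succ (Submodule.finrank_le _))
    obtain ⟨e⟩ := Function.Embedding.nonempty_of_card_le hcard
    -- pad the convex combination with zero weights
    refine ⟨(fun j => ∑ i, if e i = j then w i else 0,
      fun j => if h : ∃ i, e i = j then z h.choose else x₀), ⟨⟨fun j => ?_, ?_⟩, fun j _ => ?_⟩, ?_⟩
    · refine Finset.sum_nonneg fun i _ => ?_
      split_ifs
      exacts [(hw i).le, le_rfl]
    · rw [Finset.sum_comm]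
      simpa using hw1
    · dsimp only
      split_ifs with h
      exacts [hz ⟨_, rfl⟩, hx₀]
    · simp only [F, Finset.sum_smul]
      rw [Finset.sum_comm]
      refine Finset.sum_congr rfl fun i _ => ?_
      rw [Finset.sum_eq_single (e i)]
      · have h : ∃ i', e i' = e i := ⟨i, rfl⟩
        rw [if_pos rfl, dif_pos h, e.injective h.choose_spec]
      · intro j _ hj
        rw [if_neg (Ne.symm hj), zero_smul]
      · simp
  · rintro _ ⟨⟨w, z⟩, ⟨⟨hw, hw1⟩, hz⟩, rfl⟩
    exact (convex_convexHull ℝ s).sum_mem (fun i _ => hw i) hw1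
      fun i _ => subset_convexHull ℝ s (hz i trivial)

/-- Exact cubature: the mean of a continuous function with values in a finite-dimensional space is a
convex combination of finitely many of its values. -/
theorem exists_cubature {X : Type*} [TopologicalSpace X] [CompactSpace X] [MeasurableSpace X]
    [BorelSpace X] (μ : Measure X) [IsProbabilityMeasure μ] {f : X → V} (hf : Continuous f) :
    ∃ (N : ℕ) (w : Fin N → ℝ) (x : Fin N → X), (∀ i, 0 ≤ w i) ∧
      ∫ y, f y ∂μ = ∑ i, w i • f (x i) := by
  have hmem : ∫ y, f y ∂μ ∈ convexHull ℝ (Set.range f) :=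
    (convex_convexHull ℝ _).integral_mem
      (isCompact_convexHull_of_finiteDimensional (isCompact_range hf)).isClosed
      (Filter.Eventually.of_forall fun y => subset_convexHull ℝ _ ⟨y, rfl⟩)
      (hf.integrable_of_hasCompactSupport (HasCompactSupport.of_compactSpace _))
  obtain ⟨ι, _, z, w, hz, -, hw, -, h⟩ := eq_pos_convex_span_of_mem_convexHull hmem
  choose x hx using fun i => hz ⟨i, rfl⟩
  let e := (Fintype.equivFin ι).symm
  refine ⟨_, w ∘ e, x ∘ e, fun i => (hw _).le, ?_⟩
  rw [← h, ← e.sum_comp]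
  simp [hx]

end Cubature

/-! ### The expansion of the partial trace -/

section Expansion

variable {d : ℕ}

theorem symDim_ne_zero (hd : 1 ≤ d) (n : ℕ) : symDim d n ≠ 0 :=
  (Nat.choose_pos (by omega)).ne'

/-- A linear map on operators on the symmetric power is determined by its values at the operators
`|b⟩⟨b'|^{⊗ n}`. -/
theorem linearMap_ext_tensorPower {V : Type*} [AddCommGroup V] [Module ℂ V] {n : ℕ}
    {L L' : (Sym d n →L[ℂ] Sym d n) →ₗ[ℂ] V}
    (h : ∀ b b', L (rankOne ℂ (tensorPower n b) (tensorPower n b')) =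
      L' (rankOne ℂ (tensorPower n b) (tensorPower n b'))) : L = L' := by
  have hspan : ∀ x : Sym d n, x ∈ Submodule.span ℂ (Set.range (tensorPower (d := d) n)) := by
    simp [span_tensorPower]
  have h1 : ∀ x b', L (rankOne ℂ x (tensorPower n b')) = L' (rankOne ℂ x (tensorPower n b')) := by
    intro x b'
    induction hspan x using Submodule.span_induction with
    | mem x hx =>
      obtain ⟨b, rfl⟩ := hx
      exact h b b'
    | zero => simp
    | add x y _ _ hx hy => simp [hx, hy]
    | smul c x _ hx => simp [hx]
  have h2 : ∀ x y, L (rankOne ℂ x y) = L' (rankOne ℂ x y) := by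
    intro x y
    induction hspan y using Submodule.span_induction with
    | mem y hy =>
      obtain ⟨b', rfl⟩ := hy
      exact h1 x b'
    | zero => simp
    | add y z _ _ hy hz => simp [hy, hz]
    | smul c y _ hy => simp [hy]
  refine LinearMap.ext fun X => ?_
  obtain ⟨N, u, v, rfl, -⟩ := exists_rankOne_decomposition X
  simp [h2]

theorem adjoint_tensorWith_tensorPower {a b n : ℕ} (h : a + b = n) (v : TensorSpace d b)
    (c : EuclideanSpace ℂ (Fin d)) :
    (tensorWith h v).adjoint (symIncl d n (tensorPower n c)) =
      (inner ℂ v (symIncl d b (tensorPower b c))) • symIncl d a (tensorPower a c) := by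
  refine ext_inner_right ℂ fun w => ?_
  rw [ContinuousLinearMap.adjoint_inner_left, inner_tensorPower_tensorWith, inner_smul_left,
    inner_conj_symm, mul_comm]

theorem sum_inner_basisTensor {m : ℕ} (u v : TensorSpace d m) :
    ∑ c : Fin m → Fin d, inner ℂ u (basisTensor c) * inner ℂ (basisTensor c) v = inner ℂ u v := by
  have := (EuclideanSpace.basisFun (Fin m → Fin d) ℂ).sum_inner_mul_inner u v
  simpa [basisTensor] using this

theorem inner_clone_tensorPower {t k : ℕ} (h : t ≤ k) (Y : Sym d t →L[ℂ] Sym d t)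
    (a' a : EuclideanSpace ℂ (Fin d)) :
    inner ℂ (tensorPower k a') (clone d h Y (tensorPower k a)) =
      (symDim d t : ℂ) / symDim d k * (inner ℂ a' a ^ (k - t) *
        inner ℂ (tensorPower t a') (Y (tensorPower t a))) := by
  rw [← inner_tensorPower, inner_sym (d := d) (n := k - t), ← sum_inner_basisTensor]
  simp only [clone, LinearMap.smul_apply, smul_apply, inner_smul_right]
  congr 1
  change inner ℂ (tensorPower k a') (symProj d k ((∑ c : Fin (k - t) → Fin d,
    tensorWith (Nat.add_sub_cancel' h) (basisTensor c) ∘L (symIncl d t ∘L Y ∘L symProj d t) ∘L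
      (tensorWith (Nat.add_sub_cancel' h) (basisTensor c)).adjoint)
        (symIncl d k (tensorPower k a)))) = _
  rw [inner_symProj_right, sum_apply, inner_sum, Finset.sum_mul]
  refine Finset.sum_congr rfl fun c _ => ?_
  simp only [ContinuousLinearMap.comp_apply, adjoint_tensorWith_tensorPower, map_smul,
    inner_smul_right, inner_tensorPower_tensorWith, symProj_symIncl]
  rw [← inner_sym]
  ring

theorem inner_partialTrace_tensorPower {k n : ℕ} (h : k ≤ n)
    (b b' a' a : EuclideanSpace ℂ (Fin d)) :
    inner ℂ (tensorPower k a') (partialTrace d h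
        (rankOne ℂ (tensorPower n b) (tensorPower n b')) (tensorPower k a)) =
      inner ℂ b' a ^ k * inner ℂ a' b ^ k * inner ℂ b' b ^ (n - k) := by
  change inner ℂ (tensorPower k a') (symProj d k ((∑ c : Fin (n - k) → Fin d,
    (tensorWith (Nat.add_sub_cancel' h) (basisTensor c)).adjoint ∘L
      (symIncl d n ∘L rankOne ℂ (tensorPower n b) (tensorPower n b') ∘L symProj d n) ∘L
        tensorWith (Nat.add_sub_cancel' h) (basisTensor c)) (symIncl d k (tensorPower k a)))) = _
  rw [inner_symProj_right, sum_apply, inner_sum, ← inner_tensorPower (n := n - k),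
    inner_sym (d := d) (n := n - k), ← sum_inner_basisTensor, Finset.mul_sum]
  refine Finset.sum_congr rfl fun c _ => ?_
  simp only [ContinuousLinearMap.comp_apply, rankOne_apply, map_smul, inner_smul_right,
    inner_symProj_right, inner_tensorPower_tensorWith, adjoint_tensorWith_tensorPower]
  rw [← inner_sym, ← inner_sym, inner_tensorPower, inner_tensorPower]
  ring

theorem inner_measurePrepare {n t : ℕ} (X : Sym d n →L[ℂ] Sym d n) (u v : Sym d t) :
    inner ℂ u (measurePrepare d n t X v) = symDim d n * ∫ x : CSphere d,
      inner ℂ (tensorPower n x.1) (X (tensorPower n x.1)) *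
        (inner ℂ u (tensorPower t x.1) * inner ℂ (tensorPower t x.1) v) ∂(sphereMeasure d) := by
  have hint := integrable_measurePrepare t X
  change inner ℂ u (((symDim d n : ℂ) • ∫ x : CSphere d,
    inner ℂ (tensorPower n x.1) (X (tensorPower n x.1)) • ketbra (tensorPower t x.1)
      ∂(sphereMeasure d)) v) = _
  rw [smul_apply, inner_smul_right, ← ContinuousLinearMap.apply_apply v (∫ _, _ ∂_),
    ← ContinuousLinearMap.integral_comp_comm _ hint, ← integral_inner]
  · congr 2
    ext x
    simp [ketbra, inner_smul_right, mul_comm (inner ℂ u _)]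
  · exact ContinuousLinearMap.integrable_comp _ hint

/-- The mixed moments of the uniform measure on the sphere. Up to a constant, the left-hand side is
`⟨P (b'^{⊗ n} ⊗ a'^{⊗ t}), P (b^{⊗ n} ⊗ a^{⊗ t})⟩`, and `P (b'^{⊗ n} ⊗ a'^{⊗ t})` is obtained
from the powers of `b' + z a'` by extracting the coefficient of `z^t`. -/
theorem integral_mixed_moment (hd : 1 ≤ d) (n t : ℕ) (b b' a' a : EuclideanSpace ℂ (Fin d)) :
    ((n + t).choose t : ℂ) * ∫ x : CSphere d,
      inner ℂ x.1 b ^ n * inner ℂ b' x.1 ^ n * (inner ℂ a' x.1 ^ t * inner ℂ x.1 a ^ t)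
        ∂(sphereMeasure d) =
      (symDim d (n + t) : ℂ)⁻¹ * ((C (inner ℂ b' b) + C (inner ℂ a' b) * X) ^ n *
        (C (inner ℂ b' a) + C (inner ℂ a' a) * X) ^ t : ℂ[X]).coeff t := by
  have := isProbabilityMeasure_sphereMeasure hd
  have h1 : ∀ c', ∫ x : CSphere d,
      inner ℂ c' x.1 ^ (n + t) * (inner ℂ x.1 b ^ n * inner ℂ x.1 a ^ t)
      ∂(sphereMeasure d) =
      (symDim d (n + t) : ℂ)⁻¹ * (inner ℂ c' b ^ n * inner ℂ c' a ^ t) := by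
    intro c'
    have h := integral_inner_tensorPower_mul hd (n + t) (tensorPower (n + t) c')
      (symProj d (n + t) (tensorWith rfl (symIncl d t (tensorPower t a))
        (symIncl d n (tensorPower n b))))
    simpa only [inner_symProj_right, inner_tensorPower_tensorWith, ← inner_sym,
      inner_tensorPower] using h
  let J : ℕ → ℂ := fun i => ∫ x : CSphere d, inner ℂ a' x.1 ^ i * inner ℂ b' x.1 ^ (n + t - i) *
    (inner ℂ x.1 b ^ n * inner ℂ x.1 a ^ t) ∂(sphereMeasure d)
  have h2 : (∑ i ∈ Finset.range (n + t + 1), C (((n + t).choose i : ℂ) * J i) * X ^ i : ℂ[X]) =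
      C (symDim d (n + t) : ℂ)⁻¹ * ((C (inner ℂ b' b) + C (inner ℂ a' b) * X) ^ n *
        (C (inner ℂ b' a) + C (inner ℂ a' a) * X) ^ t) := by
    refine Polynomial.funext fun z => ?_
    have h3 := h1 (b' + (starRingEnd ℂ) z • a')
    simp only [inner_add_left, inner_smul_left, Complex.conj_conj] at h3
    simp only [eval_finsetSum, eval_mul, eval_C, eval_pow, eval_X, eval_add]
    rw [mul_comm _ z, mul_comm _ z, ← h3]
    simp only [add_comm (inner ℂ b' _) (z * inner ℂ a' _), add_pow, Finset.sum_mul]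
    rw [integral_finsetSum]
    · refine Finset.sum_congr rfl fun i _ => ?_
      rw [mul_comm, ← mul_assoc, ← integral_const_mul]
      congr 1
      ext x
      ring
    · intro i _
      refine Continuous.integrable_of_hasCompactSupport ?_ (HasCompactSupport.of_compactSpace _)
      fun_prop
  have h4 := congrArg (fun p => coeff p t) h2
  simp only [finsetSum_coeff, coeff_C_mul, coeff_X_pow, mul_ite, mul_one, mul_zero,
    Finset.sum_ite_eq, Finset.mem_range] at h4
  rw [if_pos (by omega)] at h4
  rw [← h4]
  simp only [J, Nat.add_sub_cancel]
  congr 2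
  ext x
  ring

/-- The partial trace is a combination of the maps `Clone_{t → k} ∘ MP_{n → t}`. Between powers of
vectors the `t`-th term is the coefficient of `X^k` in
`(β + γ X)^n * (-α X)^(k-t) * (η + α X)^t * C(k,t)`, up to a factor that does not depend on `t`, and
the binomial theorem sums these to the coefficient of `X^k` in `(β + γ X)^n * η^k`. -/
theorem partialTrace_eq_expansion (hd : 1 ≤ d) {k n : ℕ} (h : k ≤ n) :
    partialTrace d h = truncatedExpansion d n k k := by
  refine linearMap_ext_tensorPower fun b b' => eq_of_inner_tensorPower fun a' a => ?_
  rw [inner_partialTrace_tensorPower]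
  simp only [truncatedExpansion, LinearMap.sum_apply, sum_apply, inner_sum, LinearMap.smul_apply,
    smul_apply, inner_smul_right, LinearMap.comp_apply, inner_clone_tensorPower,
    inner_measurePrepare, rankOne_apply, inner_tensorPower]
  set α : ℂ := inner ℂ a' a
  set β : ℂ := inner ℂ b' b
  set γ : ℂ := inner ℂ a' b
  set η : ℂ := inner ℂ b' a
  let S : ℕ → ℂ := fun t => ((C β + C γ * X) ^ n * (C η + C α * X) ^ t : ℂ[X]).coeff t
  have hchoose : (n.choose k : ℂ) ≠ 0 := Nat.cast_ne_zero.2 (Nat.choose_pos h).ne'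
  have hterm : ∀ t ≤ k, ((qHat d n k t : ℝ) : ℂ) * ((symDim d t : ℂ) / symDim d k *
      (α ^ (k - t) * (symDim d n * ∫ x : CSphere d,
        inner ℂ b' x.1 ^ n * inner ℂ x.1 b ^ n * (inner ℂ a' x.1 ^ t * inner ℂ x.1 a ^ t)
          ∂(sphereMeasure d)))) =
      (n.choose k : ℂ)⁻¹ * ((-1) ^ (k - t) * k.choose t * (α ^ (k - t) * S t)) := by
    intro t ht
    have h1 := integral_mixed_moment hd n t b b' a' a
    simp only [mul_comm (inner ℂ b' _ ^ n)]
    set J := ∫ x : CSphere d,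
      inner ℂ x.1 b ^ n * inner ℂ b' x.1 ^ n * (inner ℂ a' x.1 ^ t * inner ℂ x.1 a ^ t)
        ∂(sphereMeasure d)
    have hd' : ∀ m, (symDim d m : ℂ) ≠ 0 := fun m => Nat.cast_ne_zero.2 (symDim_ne_zero hd m)
    have hS : S t = symDim d (n + t) * (((n + t).choose t : ℂ) * J) := by
      rw [h1, mul_inv_cancel_left₀ (hd' _)]
    have hsign : (-1 : ℂ) ^ (t + k) = (-1) ^ (k - t) := by
      rw [show t + k = (k - t) + 2 * t by omega, pow_add, pow_mul]
      simp
    rw [hS, qHat, qCoeff]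
    push_cast
    rw [hsign]
    have := hd' t
    have := hd' k
    have := hd' n
    have := hd' (n + k)
    field_simp
  have hsum : ∑ t ∈ Finset.range (k + 1), (-1 : ℂ) ^ (k - t) * k.choose t * (α ^ (k - t) * S t) =
      η ^ k * (n.choose k * (γ ^ k * β ^ (n - k))) := by
    have h1 : ∀ t ∈ Finset.range (k + 1),
        (-1 : ℂ) ^ (k - t) * k.choose t * (α ^ (k - t) * S t) =
          ((C β + C γ * X) ^ n *
            ((C η + C α * X) ^ t * (-(C α * X)) ^ (k - t) * (k.choose t : ℂ[X])) :
            ℂ[X]).coeff k := by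
      intro t ht
      have ht' : t ≤ k := Nat.lt_succ_iff.1 (Finset.mem_range.1 ht)
      have h2 : ((C β + C γ * X) ^ n *
          ((C η + C α * X) ^ t * (-(C α * X)) ^ (k - t) * (k.choose t : ℂ[X])) :
          ℂ[X]) = C ((-1 : ℂ) ^ (k - t) * k.choose t * α ^ (k - t)) *
            (((C β + C γ * X) ^ n * (C η + C α * X) ^ t) * X ^ (k - t)) := by
        rw [neg_pow]
        simp only [map_mul, map_pow, map_neg, map_one, map_natCast]
        ring
      rw [h2, coeff_C_mul, coeff_mul_X_pow', if_pos (Nat.sub_le k t),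
        Nat.sub_sub_self ht']
      ring
    rw [Finset.sum_congr rfl h1, ← finsetSum_coeff, ← Finset.mul_sum, ← add_pow]
    have h3 : (C η + C α * X + -(C α * X) : ℂ[X]) = C η := by ring
    rw [h3, ← C_pow, mul_comm, coeff_C_mul, add_comm, add_pow, finsetSum_coeff]
    congr 1
    have h4 : ∀ i ∈ Finset.range (n + 1),
        ((C γ * X) ^ i * C β ^ (n - i) * (n.choose i : ℂ[X])).coeff k
        = if i = k then (n.choose k * (γ ^ k * β ^ (n - k)) : ℂ) else 0 := by
      intro i _
      have h5 : ((C γ * X) ^ i * C β ^ (n - i) * (n.choose i : ℂ[X])) =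
          C (n.choose i * (γ ^ i * β ^ (n - i))) * X ^ i := by
        simp only [map_mul, map_pow, map_natCast]
        ring
      rw [h5, coeff_C_mul, coeff_X_pow]
      split_ifs with h6 h7 h7
      · rw [h7, mul_one]
      · exact absurd h6.symm h7
      · exact absurd h7.symm h6
      · rw [mul_zero]
    rw [Finset.sum_congr rfl h4, Finset.sum_ite_eq' , if_pos (Finset.mem_range.2 (by omega))]
  have hfin : ∀ s ∈ Finset.range (k + 1), ((qHat d n k (k - s) : ℝ) : ℂ) *
      ((symDim d (k - s) : ℂ) / symDim d k *
      (α ^ (k - (k - s)) * (symDim d n * ∫ x : CSphere d,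
        inner ℂ b' x.1 ^ n * inner ℂ x.1 b ^ n *
          (inner ℂ a' x.1 ^ (k - s) * inner ℂ x.1 a ^ (k - s)) ∂(sphereMeasure d)))) =
      (n.choose k : ℂ)⁻¹ * ((-1) ^ (k - (k - s)) * k.choose (k - s) *
        (α ^ (k - (k - s)) * S (k - s))) := fun s _ => hterm (k - s) (Nat.sub_le k s)
  rw [Finset.sum_congr rfl hfin, ← Finset.mul_sum,
    Finset.sum_flip fun t => (-1 : ℂ) ^ (k - t) * k.choose t * (α ^ (k - t) * S t), hsum]
  field_simp

end Expansion

/-! ### Cloning and measure-and-prepare maps are channels -/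

section CloneAndMeasurePrepare

variable {d : ℕ}

theorem clone_rankOne {k n : ℕ} (h : k ≤ n) (x y : Sym d k) :
    clone d h (rankOne ℂ x y) = ∑ c : Fin (n - k) → Fin d, ((symDim d k : ℂ) / symDim d n) •
      rankOne ℂ
        (symProj d n (tensorWith (Nat.add_sub_cancel' h) (basisTensor c) (symIncl d k x)))
        (symProj d n (tensorWith (Nat.add_sub_cancel' h) (basisTensor c) (symIncl d k y))) := by
  rw [← Finset.smul_sum]
  ext1 v
  change ((symDim d k : ℂ) / symDim d n) • symProj d n ((∑ c : Fin (n - k) → Fin d,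
    tensorWith (Nat.add_sub_cancel' h) (basisTensor c) ∘L
      (symIncl d k ∘L rankOne ℂ x y ∘L symProj d k) ∘L
      (tensorWith (Nat.add_sub_cancel' h) (basisTensor c)).adjoint) (symIncl d n v)) = _
  rw [smul_apply, sum_apply, sum_apply, map_sum]
  congr 1
  refine Finset.sum_congr rfl fun c _ => ?_
  simp only [ContinuousLinearMap.comp_apply, rankOne_apply, map_smul, inner_symProj_left,
    inner_symProj_right, ContinuousLinearMap.adjoint_inner_right]

/-- The normalisation of the cloning map is a consequence of the resolution of the identity. -/
theorem isChannel_clone (hd : 1 ≤ d) {k n : ℕ} (h : k ≤ n) : IsChannel (clone d h) := by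
  have := isProbabilityMeasure_sphereMeasure hd
  have hd' : ∀ m, (symDim d m : ℂ) ≠ 0 := fun m => Nat.cast_ne_zero.2 (symDim_ne_zero hd m)
  set r : ℝ := (symDim d k : ℝ) / symDim d n
  have hr : 0 ≤ r := by positivity
  let K : (Fin (n - k) → Fin d) → Sym d k →L[ℂ] Sym d n := fun c =>
    symProj d n ∘L tensorWith (Nat.add_sub_cancel' h) (basisTensor c) ∘L symIncl d k
  refine IsChannel.of_fintype (fun c => (Real.sqrt r : ℂ) • K c) (fun x y => ?_) fun x => ?_
  · rw [clone_rankOne]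
    refine Finset.sum_congr rfl fun c _ => ?_
    simp only [smul_apply, map_smul, map_smulₛₗ, Complex.conj_ofReal, smul_smul]
    rw [← Complex.ofReal_mul, Real.mul_self_sqrt hr]
    simp [r, K]
  · have h1 : ∀ c, inner ℂ (K c x) (K c x) = symDim d n * ∫ y : CSphere d,
        inner ℂ x (tensorPower k y.1) * inner ℂ (tensorPower k y.1) x *
          (inner ℂ (symIncl d (n - k) (tensorPower (n - k) y.1)) (basisTensor c) *
            inner ℂ (basisTensor c) (symIncl d (n - k) (tensorPower (n - k) y.1)))
          ∂(sphereMeasure d) := by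
      intro c
      have h2 := integral_inner_tensorPower_mul hd n (K c x) (K c x)
      rw [← inv_mul_eq_iff_eq_mul₀ (hd' n), ← h2]
      congr 1
      ext y
      have h3 : inner ℂ (tensorPower n y.1) (K c x) = inner ℂ (tensorPower k y.1) x *
          inner ℂ (symIncl d (n - k) (tensorPower (n - k) y.1)) (basisTensor c) := by
        simp only [K, ContinuousLinearMap.comp_apply, inner_symProj_right,
          inner_tensorPower_tensorWith, ← inner_sym]
      rw [← inner_conj_symm (K c x), h3, map_mul, inner_conj_symm, inner_conj_symm]
      ring
    have h4 : ∑ c, inner ℂ (K c x) (K c x) = (symDim d n : ℂ) / symDim d k * inner ℂ x x := by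
      have hk := continuous_tensorPower d k
      have hnk := continuous_tensorPower d (n - k)
      simp only [h1]
      rw [← Finset.mul_sum, ← integral_finsetSum]
      · simp only [← Finset.mul_sum, sum_inner_basisTensor, ← inner_sym, inner_tensorPower,
          inner_self_eq_norm_sq_to_K (𝕜 := ℂ) (_ : EuclideanSpace ℂ (Fin d)), norm_eq_of_mem_sphere]
        simp only [RCLike.ofReal_one, one_pow, mul_one]
        rw [integral_inner_tensorPower_mul hd]
        ring
      · intro c _
        refine Continuous.integrable_of_hasCompactSupport ?_ (HasCompactSupport.of_compactSpace _)
        fun_prop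
    have h5 : ∑ c, ‖K c x‖ ^ 2 = (symDim d n : ℝ) / symDim d k * ‖x‖ ^ 2 := by
      simp only [inner_self_eq_norm_sq_to_K] at h4
      exact Complex.ofReal_injective (by simpa using h4)
    have h6 : ∀ c, ‖((Real.sqrt r : ℂ) • K c) x‖ ^ 2 = r * ‖K c x‖ ^ 2 := by
      intro c
      rw [smul_apply, norm_smul, mul_pow, Complex.norm_real, Real.norm_eq_abs, sq_abs,
        Real.sq_sqrt hr]
    simp only [h6]
    rw [← Finset.mul_sum, h5]
    have := symDim_ne_zero hd k
    have := symDim_ne_zero hd n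
    simp only [r]
    field_simp

/-- The measure-and-prepare map with a finite measurement: the integral is replaced by a cubature
formula that is exact for it and for the resolution of the identity. -/
theorem exists_finite_measurePrepare (hd : 1 ≤ d) (n k : ℕ) :
    ∃ (N : ℕ) (w : Fin N → ℝ) (φ : Fin N → EuclideanSpace ℂ (Fin d)),
      (∀ i, 0 ≤ w i) ∧ (∀ i, ‖φ i‖ = 1) ∧
      (∀ X, measurePrepare d n k X = ∑ i, ((w i : ℂ) *
        inner ℂ (tensorPower n (φ i)) (X (tensorPower n (φ i)))) • ketbra (tensorPower k (φ i))) ∧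
      ∀ u : Sym d n, ∑ i, w i * ‖inner ℂ (tensorPower n (φ i)) u‖ ^ 2 = ‖u‖ ^ 2 := by
  have := isProbabilityMeasure_sphereMeasure hd
  have hn := continuous_tensorPower d n
  let G : CSphere d → (Sym d n →L[ℂ] Sym d n) →L[ℂ] (Sym d k →L[ℂ] Sym d k) := fun x =>
    (innerSL ℂ (tensorPower n x.1) ∘L
      ContinuousLinearMap.apply ℂ (Sym d n) (tensorPower n x.1)).smulRight
        (ketbra (tensorPower k x.1))
  have hG : Continuous G := continuous_clm_apply.2 fun X => continuous_measurePrepare k X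
  have hGint : Integrable G (sphereMeasure d) :=
    hG.integrable_of_hasCompactSupport (HasCompactSupport.of_compactSpace _)
  have hP := continuous_ketbra_tensorPower d n
  have hPint : Integrable (fun x : CSphere d => ketbra (tensorPower n x.1)) (sphereMeasure d) :=
    hP.integrable_of_hasCompactSupport (HasCompactSupport.of_compactSpace _)
  have : FiniteDimensional ℝ (Sym d n →L[ℂ] Sym d n) := FiniteDimensional.complexToReal _
  have : FiniteDimensional ℝ ((Sym d n →L[ℂ] Sym d n) →L[ℂ] (Sym d k →L[ℂ] Sym d k)) :=
    FiniteDimensional.complexToReal _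
  obtain ⟨N, w, x, hw, h⟩ := exists_cubature (sphereMeasure d) (hP.prodMk hG)
  rw [integral_pair hPint hGint] at h
  have h1 := congrArg Prod.fst h
  have h2 := congrArg Prod.snd h
  simp only [Prod.fst_sum, Prod.snd_sum, Prod.smul_fst, Prod.smul_snd] at h1 h2
  refine ⟨N, fun i => symDim d n * w i, fun i => (x i).1,
    fun i => mul_nonneg (by positivity) (hw i),
    fun i => by simp, fun X => ?_, fun u => ?_⟩
  · have h3 := congrArg (fun T => T X) h2
    simp only [ContinuousLinearMap.integral_apply hGint, sum_apply, smul_apply] at h3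
    change (symDim d n : ℂ) • ∫ x : CSphere d, G x X ∂(sphereMeasure d) = _
    rw [h3, Finset.smul_sum]
    refine Finset.sum_congr rfl fun i _ => ?_
    rw [← Complex.coe_smul, smul_smul]
    simp [G, smul_smul]
  · have h3 := inner_integral_ketbra_tensorPower (d := d) u u
    rw [integral_inner_tensorPower_mul hd, h1] at h3
    simp only [sum_apply, smul_apply, inner_sum, ketbra, rankOne_apply] at h3
    refine Complex.ofReal_injective ?_
    have h4 := congrArg (fun z => (symDim d n : ℂ) * z) h3
    rw [mul_inv_cancel_left₀ (Nat.cast_ne_zero.2 (symDim_ne_zero hd n)),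
      inner_self_eq_norm_sq_to_K, Finset.mul_sum] at h4
    push_cast
    refine Eq.trans (Finset.sum_congr rfl fun i _ => ?_) h4
    rw [← Complex.coe_smul, inner_smul_right, inner_smul_right,
      ← inner_conj_symm u (tensorPower n _), Complex.mul_conj']
    ring

theorem isChannel_measurePrepare (hd : 1 ≤ d) (n k : ℕ) : IsChannel (measurePrepare d n k) := by
  obtain ⟨N, w, φ, hw, hφ, hX, hu⟩ := exists_finite_measurePrepare hd n k
  refine ⟨N, fun i => (Real.sqrt (w i) : ℂ) • rankOne ℂ (tensorPower k (φ i)) (tensorPower n (φ i)),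
    fun x y => ?_, fun x => ?_⟩
  · rw [hX]
    refine Finset.sum_congr rfl fun i _ => ?_
    simp only [smul_apply, rankOne_apply, map_smul, map_smulₛₗ, smul_smul, inner_smul_right, ketbra,
      map_mul, Complex.conj_ofReal, inner_conj_symm]
    congr 1
    have : (w i : ℂ) = (Real.sqrt (w i) : ℂ) * (Real.sqrt (w i) : ℂ) := by
      rw [← Complex.ofReal_mul, Real.mul_self_sqrt (hw i)]
    rw [this]
    ring
  · rw [← hu]
    refine Finset.sum_congr rfl fun i _ => ?_
    rw [smul_apply, rankOne_apply, norm_smul, norm_smul, norm_tensorPower, hφ, one_pow, mul_one,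
      mul_pow, Complex.norm_real, Real.norm_eq_abs, sq_abs, Real.sq_sqrt (hw i)]

end CloneAndMeasurePrepare

/-! ### Almost product states -/

section AlmostProduct

variable {d : ℕ}

theorem tensorWith_tensorPower_assoc {a b c m k r : ℕ} (h : a + b = k) (h' : c + r = k)
    (hm : c + m = a) (hr : m + b = r) (φ : EuclideanSpace ℂ (Fin d)) (ψ : TensorSpace d b) :
    tensorWith h' (tensorWith hr ψ (symIncl d m (tensorPower m φ)))
      (symIncl d c (tensorPower c φ)) = tensorWith h ψ (symIncl d a (tensorPower a φ)) := by
  subst hm hr h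
  ext f
  simp only [tensorWith, LinearMap.coe_toContinuousLinearMap', LinearMap.coe_mk, AddHom.coe_mk,
    symIncl_tensorPower_apply]
  rw [Fin.prod_univ_add, mul_assoc]
  have h1 : ∀ j, Fin.cast h' (Fin.natAdd c (Fin.natAdd m j)) = Fin.natAdd (c + m) j :=
    fun j => Fin.ext (Nat.add_assoc c m j).symm
  simp only [Fin.cast_refl, id_eq, h1]
  rfl

/-- Factors `φ` may be moved into the unconstrained part of an almost product vector. -/
theorem tensorWith_tensorPower_mem {a b k r : ℕ} (h : a + b = k) (hr : r ≤ k) (hbr : b ≤ r)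
    (φ : EuclideanSpace ℂ (Fin d)) (ψ : TensorSpace d b) :
    symProj d k (tensorWith h ψ (symIncl d a (tensorPower a φ))) ∈
      almostProductSpace d k r hr φ := by
  rw [← tensorWith_tensorPower_assoc h (Nat.sub_add_cancel hr)
    (by omega : k - r + (r - b) = a) (by omega)]
  exact Submodule.subset_span ⟨_, rfl⟩

/-- A non-negative combination of the operators `|w⟩⟨w|`, for almost product vectors `w`, is an
almost product state as soon as it has trace `1`. -/
theorem mem_almostProductStates {k r : ℕ} {hr : r ≤ k} {ι : Type*} [Fintype ι] (c : ι → ℝ)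
    (w : ι → Sym d k) (hc : ∀ i, 0 ≤ c i) (hw : ∀ i, w i ∈ almostProductVectors d k r hr)
    (htr : IsState (∑ i, (c i : ℂ) • ketbra (w i))) :
    ∑ i, (c i : ℂ) • ketbra (w i) ∈ almostProductStates d k r hr := by
  classical
  have h1 : ∑ i, c i * ‖w i‖ ^ 2 = 1 := by
    have h := htr.2
    simp only [ketbra, ContinuousLinearMap.toLinearMap_sum, ContinuousLinearMap.toLinearMap_smul,
      map_sum, map_smul, trace_rankOne, inner_self_eq_norm_sq_to_K, smul_eq_mul] at h
    exact Complex.ofReal_injective (by simpa using h)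
  set s : Finset ι := {i | w i ≠ 0}
  have hs : ∀ i, i ∉ s → w i = 0 := by simp [s]
  have h2 : ∑ i, (c i : ℂ) • ketbra (w i) =
      ∑ i ∈ s, (c i * ‖w i‖ ^ 2) • ketbra ((‖w i‖⁻¹ : ℂ) • w i) := by
    rw [← Finset.sum_subset (Finset.subset_univ s)]
    · refine Finset.sum_congr rfl fun i hi => ?_
      have hi' : (‖w i‖ : ℂ) ≠ 0 := by
        exact_mod_cast norm_ne_zero_iff.2 (Finset.mem_filter.1 hi).2
      rw [← Complex.coe_smul]
      simp only [ketbra, map_smul, map_smulₛₗ, smul_apply, smul_smul, map_inv₀, Complex.conj_ofReal]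
      congr 1
      push_cast
      field_simp
    · intro i _ hi
      simp [ketbra, hs i hi]
  rw [h2]
  refine (convex_convexHull ℝ _).sum_mem (fun i _ => mul_nonneg (hc i) (by positivity)) ?_
    fun i hi => subset_convexHull ℝ _ ⟨_, ?_, ?_, rfl⟩
  · rw [← h1, ← Finset.sum_subset (Finset.subset_univ s)]
    intro i _ hi
    simp [hs i hi]
  · obtain ⟨φ, hφ⟩ := Set.mem_iUnion.1 (hw i)
    exact Set.mem_iUnion.2 ⟨φ, Submodule.smul_mem _ _ hφ⟩
  · have hi' : ‖w i‖ ≠ 0 := norm_ne_zero_iff.2 (Finset.mem_filter.1 hi).2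
    simp [norm_smul, hi']

theorem clone_measurePrepare_mem_almostProductStates (hd : 1 ≤ d) {n k r s : ℕ} (hr : r ≤ k)
    (hs : s ≤ r) {ρ : Sym d n →L[ℂ] Sym d n} (hρ : IsState ρ) :
    clone d (Nat.sub_le k s) (measurePrepare d n (k - s) ρ) ∈ almostProductStates d k r hr := by
  have hstate : IsState (clone d (Nat.sub_le k s) (measurePrepare d n (k - s) ρ)) :=
    (isChannel_clone hd _).isState ((isChannel_measurePrepare hd n _).isState hρ)
  obtain ⟨N, w, φ, hw, -, hX, -⟩ := exists_finite_measurePrepare hd n (k - s)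
  have hpos : ∀ i, 0 ≤ (inner ℂ (tensorPower n (φ i)) (ρ (tensorPower n (φ i)))).re ∧
      inner ℂ (tensorPower n (φ i)) (ρ (tensorPower n (φ i))) =
        ((inner ℂ (tensorPower n (φ i)) (ρ (tensorPower n (φ i)))).re : ℂ) := by
    intro i
    have := hρ.1.inner_nonneg_right (tensorPower n (φ i))
    exact ⟨(Complex.nonneg_iff.1 this).1, Complex.ext rfl (Complex.nonneg_iff.1 this).2.symm⟩
  have h1 : clone d (Nat.sub_le k s) (measurePrepare d n (k - s) ρ) =
      ∑ p : Fin N × (Fin (k - (k - s)) → Fin d),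
        ((w p.1 * (inner ℂ (tensorPower n (φ p.1)) (ρ (tensorPower n (φ p.1)))).re *
          ((symDim d (k - s) : ℝ) / symDim d k) : ℝ) : ℂ) •
        ketbra (symProj d k (tensorWith (Nat.add_sub_cancel' (Nat.sub_le k s)) (basisTensor p.2)
          (symIncl d (k - s) (tensorPower (k - s) (φ p.1))))) := by
    rw [hX, map_sum, Fintype.sum_prod_type]
    refine Finset.sum_congr rfl fun i _ => ?_
    rw [map_smul, ketbra, clone_rankOne, Finset.smul_sum]
    refine Finset.sum_congr rfl fun c _ => ?_
    rw [smul_smul, (hpos i).2]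
    simp [ketbra]
  rw [h1] at hstate ⊢
  refine mem_almostProductStates _ _ (fun p => ?_) (fun p => ?_) hstate
  · exact mul_nonneg (mul_nonneg (hw _) (hpos _).1) (by positivity)
  · exact Set.mem_iUnion.2 ⟨φ p.1, tensorWith_tensorPower_mem _ hr (by omega) _ _⟩

end AlmostProduct

/-! ### Estimates for the coefficients -/

section Coefficients

variable {d : ℕ}

theorem symDim_succ (hd : 1 ≤ d) (m : ℕ) :
    (symDim d (m + 1) : ℝ) * (m + 1) = symDim d m * (d + m) := by
  obtain ⟨e, rfl⟩ := Nat.exists_eq_add_of_le' hd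
  have h := Nat.add_one_mul_choose_eq (e + m) m
  have h1 : symDim (e + 1) (m + 1) = (e + m + 1).choose (m + 1) := by
    rw [symDim]; congr 1; omega
  have h2 : symDim (e + 1) m = (e + m).choose m := by
    rw [symDim]; congr 1; omega
  rw [h1, h2]
  have h3 : (((e + m + 1) * (e + m).choose m : ℕ) : ℝ) =
    (((e + m + 1).choose (m + 1) * (m + 1) : ℕ) : ℝ) := congrArg _ h
  push_cast at h3 ⊢
  linarith

theorem symDim_pos (hd : 1 ≤ d) (m : ℕ) : (0 : ℝ) < symDim d m :=
  Nat.cast_pos.2 (Nat.pos_of_ne_zero (symDim_ne_zero hd m))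

theorem abs_qHat (hd : 1 ≤ d) (n k t : ℕ) :
    |qHat d n k t| = ((n + t).choose t : ℝ) * k.choose t / n.choose k *
      (symDim d (n + t) * symDim d k / (symDim d n * symDim d t)) := by
  have := (symDim_pos hd (n + k)).ne'
  have := (symDim_pos hd n).ne'
  have := (symDim_pos hd t).ne'
  have h : qHat d n k t = (-1) ^ (t + k) * (((n + t).choose t : ℝ) * k.choose t / n.choose k *
      (symDim d (n + t) * symDim d k / (symDim d n * symDim d t))) := by
    rw [qHat, qCoeff]
    field_simp
  rw [h, abs_mul, abs_pow, abs_neg, abs_one, one_pow, one_mul, abs_of_nonneg (by positivity)]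

theorem choose_add_succ (n u : ℕ) :
    ((n + (u + 1)).choose (u + 1) : ℝ) * (u + 1) = (n + u + 1) * (n + u).choose u := by
  exact_mod_cast (Nat.add_one_mul_choose_eq (n + u) u).symm

theorem choose_succ_mul {k u : ℕ} (hu : u < k) :
    (k.choose (u + 1) : ℝ) * (u + 1) = k.choose u * (k - u) := by
  have h := Nat.choose_succ_right_eq k u
  rw [← Nat.cast_sub hu.le]
  exact_mod_cast h

theorem deltaParam_nonneg (hd : 1 ≤ d) (n k : ℕ) : 0 ≤ deltaParam d n k := by
  have : (1 : ℝ) ≤ d := by exact_mod_cast hd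
  have : (0 : ℝ) ≤ k := by positivity
  have : (0 : ℝ) ≤ n := by positivity
  exact div_nonneg (mul_nonneg (by linarith) (by linarith)) (by linarith)

/-- Successive coefficients decrease by a factor `δ`: the ratio is
`(u+1)(u+d) / ((k-u)(n+u+d))`, and it is largest for `u + 1 = k`. -/
theorem abs_qHat_le_mul (hd : 1 ≤ d) {n k u : ℕ} (hu : u < k) (hkn : k < n) :
    |qHat d n k u| ≤ deltaParam d n k * |qHat d n k (u + 1)| := by
  have hd1 : (1 : ℝ) ≤ d := by exact_mod_cast hd
  have hu1 : (u : ℝ) + 1 ≤ k := by exact_mod_cast hu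
  have hu0 : (0 : ℝ) ≤ u := by positivity
  have hn0 : (0 : ℝ) < n := by exact_mod_cast (by omega : 0 < n)
  have e1 := choose_add_succ n u
  have e2 := choose_succ_mul hu
  have e3 := symDim_succ hd (n + u)
  have e4 := symDim_succ hd u
  have p0 := symDim_pos hd n
  have p1 := symDim_pos hd (n + u)
  have p2 := symDim_pos hd u
  have p3 := symDim_pos hd (u + 1)
  have p4 := symDim_pos hd k
  have p5 : (0 : ℝ) < n.choose k := by exact_mod_cast Nat.choose_pos hkn.le
  push_cast at e3
  have hrec : |qHat d n k u| * ((k - u) * (d + n + u)) =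
      |qHat d n k (u + 1)| * ((u + 1) * (d + u)) := by
    rw [abs_qHat hd, abs_qHat hd]
    have f1 : ((n + (u + 1)).choose (u + 1) : ℝ) = (n + u + 1) * (n + u).choose u / (u + 1) := by
      rw [eq_div_iff (by positivity), e1]
    have f2 : (k.choose (u + 1) : ℝ) = k.choose u * (k - u) / (u + 1) := by
      rw [eq_div_iff (by positivity), e2]
    have f3 : (symDim d (n + (u + 1)) : ℝ) = symDim d (n + u) * (d + (n + u)) / (n + u + 1) := by
      rw [eq_div_iff (by positivity), ← e3]
      rfl
    have f4 : (symDim d (u + 1) : ℝ) = symDim d u * (d + u) / (u + 1) := by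
      rw [eq_div_iff (by positivity), e4]
    rw [f1, f2, f3, f4]
    have : (d : ℝ) + u ≠ 0 := by positivity
    field_simp
    ring
  have hden : (0 : ℝ) < (k - u) * (d + n + u) := mul_pos (by linarith) (by linarith)
  have hratio : ((u : ℝ) + 1) * (d + u) ≤ deltaParam d n k * ((k - u) * (d + n + u)) := by
    have hD : (0 : ℝ) < n + k + d - 1 := by linarith
    have h1 : ((u : ℝ) + 1) * (d + u) ≤ deltaParam d n k * (d + n + u) := by
      rw [deltaParam, div_mul_eq_mul_div, le_div_iff₀ hD]
      have a1 : ((u : ℝ) + 1) * (d + u) ≤ k * (k + d - 1) :=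
        mul_le_mul hu1 (by linarith) (by linarith) (by linarith)
      have a2 : ((u : ℝ) + 1) * (d + u) * k ≤ k * (k + d - 1) * (u + 1) := by
        have : (0 : ℝ) ≤ k * (u + 1) := by positivity
        nlinarith
      nlinarith
    refine h1.trans (mul_le_mul_of_nonneg_left ?_ (deltaParam_nonneg hd n k))
    exact le_mul_of_one_le_left (by linarith) (by linarith)
  refine le_of_mul_le_mul_right ?_ hden
  rw [hrec]
  calc _ ≤ |qHat d n k (u + 1)| * (deltaParam d n k * ((k - u) * (d + n + u))) :=
        mul_le_mul_of_nonneg_left hratio (abs_nonneg _)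
    _ = _ := by ring

theorem abs_qHat_sub_le (hd : 1 ≤ d) {n k s : ℕ} (hs : s ≤ k) (hkn : k < n) :
    |qHat d n k (k - s)| ≤ |qHat d n k k| * deltaParam d n k ^ s := by
  induction s with
  | zero => simp
  | succ s ih =>
    have h := abs_qHat_le_mul (d := d) hd (u := k - (s + 1)) (by omega) hkn
    rw [show k - (s + 1) + 1 = k - s by omega] at h
    refine h.trans ?_
    rw [pow_succ, ← mul_assoc, mul_comm]
    exact mul_le_mul_of_nonneg_right (ih (by omega)) (deltaParam_nonneg hd n k)

/-- The inverse of the leading coefficient `|q̂(n,j,j)|` is the product of the factors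
`1 - (d+2i)/(n+d+i)`, `i < j`, hence at least `1 - ∑ (d+2i)/(n+d)`. -/
theorem one_sub_le_inv_abs_qHat (hd : 1 ≤ d) {n j : ℕ} (hj : j ≤ n) :
    1 - j * (j + d - 1) / (n + d) ≤ |qHat d n j j|⁻¹ ∧ |qHat d n j j|⁻¹ ≤ 1 ∧
      0 < |qHat d n j j|⁻¹ := by
  have hd1 : (1 : ℝ) ≤ d := by exact_mod_cast hd
  induction j with
  | zero =>
    have := (symDim_pos hd 0).ne'
    have := (symDim_pos hd n).ne'
    simp [abs_qHat hd]
    field_simp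
    simp
  | succ j ih =>
    obtain ⟨h1, h2, h3⟩ := ih (by omega)
    have hj1 : (j : ℝ) + 1 ≤ n := by exact_mod_cast hj
    have hj0 : (0 : ℝ) ≤ j := by positivity
    have hn0 : (0 : ℝ) < n := by linarith
    have e1 := choose_add_succ n j
    have e2 := choose_succ_mul (k := n) (u := j) (by omega)
    have e3 := symDim_succ hd (n + j)
    push_cast at e3
    have p0 := symDim_pos hd n
    have p1 := symDim_pos hd (n + j)
    have p2 := symDim_pos hd j
    have p3 := symDim_pos hd (j + 1)
    have p4 : (0 : ℝ) < n.choose j := by exact_mod_cast Nat.choose_pos (by omega)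
    have p5 : (0 : ℝ) < (n + j).choose j := by exact_mod_cast Nat.choose_pos (by omega)
    have hrec : |qHat d n (j + 1) (j + 1)|⁻¹ = |qHat d n j j|⁻¹ * ((n - j) / (n + d + j)) := by
      rw [abs_qHat hd, abs_qHat hd]
      have f1 : ((n + (j + 1)).choose (j + 1) : ℝ) = (n + j + 1) * (n + j).choose j / (j + 1) := by
        rw [eq_div_iff (by positivity), e1]
      have f2 : (n.choose (j + 1) : ℝ) = n.choose j * (n - j) / (j + 1) := by
        rw [eq_div_iff (by positivity), e2]
      have f3 : (symDim d (n + (j + 1)) : ℝ) = symDim d (n + j) * (d + (n + j)) / (n + j + 1) := by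
        rw [eq_div_iff (by positivity), ← e3]
        rfl
      rw [f1, f2, f3]
      have : (n : ℝ) - j ≠ 0 := by linarith
      have : (d : ℝ) + (n + j) ≠ 0 := by positivity
      simp only [Nat.choose_self, Nat.cast_one]
      field_simp
      ring
    set g := |qHat d n j j|⁻¹
    have hD : (0 : ℝ) < n + d + j := by linarith
    have hsplit : g * ((n - j) / (n + d + j)) = g - g * ((d + 2 * j) / (n + d + j)) := by
      field_simp
      ring
    have hy : (d + 2 * j : ℝ) / (n + d + j) ≤ (d + 2 * j) / (n + d) :=
      div_le_div_of_nonneg_left (by linarith) (by linarith) (by linarith)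
    have hy0 : (0 : ℝ) ≤ (d + 2 * j) / (n + d + j) := by positivity
    rw [hrec]
    refine ⟨?_, ?_, mul_pos h3 (div_pos (by linarith) hD)⟩
    · rw [hsplit]
      have h4 : g * ((d + 2 * j) / (n + d + j)) ≤ (d + 2 * j) / (n + d) :=
        (mul_le_of_le_one_left hy0 h2).trans hy
      have h5 : (1 : ℝ) - ((j + 1 : ℕ) : ℝ) * (((j + 1 : ℕ) : ℝ) + d - 1) / (n + d) =
          1 - j * (j + d - 1) / (n + d) - (d + 2 * j) / (n + d) := by
        push_cast
        ring
      rw [h5]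
      linarith
    · rw [hsplit]
      have := mul_nonneg h3.le hy0
      linarith

theorem truncationError_le (hd : 1 ≤ d) {n k : ℕ} (hk : 1 ≤ k) (hkn : k < n)
    (hδ : deltaParam d n k < 1 / 3) (r : ℕ) :
    truncationError d n k r ≤ deltaParam d n k ^ (r + 1) / (1 - 3 * deltaParam d n k) := by
  have hd1 : (1 : ℝ) ≤ d := by exact_mod_cast hd
  have hk1 : (1 : ℝ) ≤ k := by exact_mod_cast hk
  have hkn1 : (k : ℝ) < n := by exact_mod_cast hkn
  obtain ⟨h1, h2, h3⟩ := one_sub_le_inv_abs_qHat hd hkn.le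
  have h0 := deltaParam_nonneg hd n k
  -- `n + k + d - 1 ≤ 2 (n + d)`
  have h4 : (k : ℝ) * (k + d - 1) / (n + d) ≤ 2 * deltaParam d n k := by
    rw [deltaParam, ← mul_div_assoc, div_le_div_iff₀ (by linarith) (by linarith)]
    have : (0 : ℝ) ≤ k * (k + d - 1) := mul_nonneg (by linarith) (by linarith)
    nlinarith
  set δ := deltaParam d n k
  have hQ : |qHat d n k k| * (1 - 2 * δ) ≤ 1 := by
    have hQ0 : 0 < |qHat d n k k| := inv_pos.1 h3
    calc _ ≤ |qHat d n k k| * |qHat d n k k|⁻¹ := mul_le_mul_of_nonneg_left (by linarith) hQ0.le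
      _ = 1 := mul_inv_cancel₀ hQ0.ne'
  have hQ' : |qHat d n k k| / (1 - δ) ≤ 1 / (1 - 3 * δ) := by
    rw [div_le_div_iff₀ (by linarith) (by linarith)]
    have h5 : 1 - 3 * δ ≤ (1 - 2 * δ) * (1 - δ) := by nlinarith
    calc |qHat d n k k| * (1 - 3 * δ) ≤ |qHat d n k k| * ((1 - 2 * δ) * (1 - δ)) :=
          mul_le_mul_of_nonneg_left h5 (abs_nonneg _)
      _ = |qHat d n k k| * (1 - 2 * δ) * (1 - δ) := by ring
      _ ≤ 1 * (1 - δ) := mul_le_mul_of_nonneg_right hQ (by linarith)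
  calc truncationError d n k r ≤ ∑ s ∈ Finset.Icc (r + 1) k, |qHat d n k k| * δ ^ s :=
        Finset.sum_le_sum fun s hs => abs_qHat_sub_le hd (Finset.mem_Icc.1 hs).2 hkn
    _ = |qHat d n k k| * ∑ s ∈ Finset.Ico (r + 1) (k + 1), δ ^ s := by
        rw [Finset.mul_sum]
        rfl
    _ ≤ |qHat d n k k| * (δ ^ (r + 1) / (1 - δ)) :=
        mul_le_mul_of_nonneg_left (geom_sum_Ico_le_of_lt_one h0 (by linarith)) (abs_nonneg _)
    _ = δ ^ (r + 1) * (|qHat d n k k| / (1 - δ)) := by ring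
    _ ≤ δ ^ (r + 1) * (1 / (1 - 3 * δ)) := mul_le_mul_of_nonneg_left hQ' (by positivity)
    _ = _ := by ring

theorem deltaParam_lt_iff (hd : 1 ≤ d) {n k : ℕ} (hk : 1 ≤ k) :
    deltaParam d n k < 1 / 3 ↔
      (k : ℝ) < (Real.sqrt (12 * n + (3 * d - 2) ^ 2) + 4 - 3 * d) / 6 := by
  have hd1 : (1 : ℝ) ≤ d := by exact_mod_cast hd
  have hk1 : (1 : ℝ) ≤ k := by exact_mod_cast hk
  have hn0 : (0 : ℝ) ≤ n := by positivity
  have h1 : (k : ℝ) < (Real.sqrt (12 * n + (3 * d - 2) ^ 2) + 4 - 3 * d) / 6 ↔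
      6 * k + 3 * d - 4 < Real.sqrt (12 * n + (3 * d - 2) ^ 2) := by
    rw [lt_div_iff₀ (by norm_num)]
    constructor <;> intro h <;> linarith
  rw [h1, Real.lt_sqrt (by linarith), deltaParam, div_lt_div_iff₀ (by linarith) (by norm_num)]
  constructor <;> intro h <;> nlinarith

end Coefficients

/-! ### Truncation of the expansion -/

section Truncation

variable {d : ℕ}

theorem partialTrace_sub_truncatedExpansion (hd : 1 ≤ d) {n k r : ℕ} (hkn : k ≤ n) (hr : r ≤ k) :
    partialTrace d hkn - truncatedExpansion d n k r = ∑ s ∈ Finset.Icc (r + 1) k,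
      ((qHat d n k (k - s) : ℝ) : ℂ) •
        (clone d (Nat.sub_le k s) ∘ₗ measurePrepare d n (k - s)) := by
  rw [partialTrace_eq_expansion hd, truncatedExpansion, truncatedExpansion,
    ← Finset.sum_Ico_eq_sub _ (Nat.succ_le_succ hr)]
  rfl

theorem diamondNorm_partialTrace_sub_le (hd : 1 ≤ d) {n k r : ℕ} (hkn : k ≤ n) (hr : r ≤ k) :
    diamondNorm (partialTrace d hkn - truncatedExpansion d n k r) ≤
      ENNReal.ofReal (truncationError d n k r) := by
  rw [partialTrace_sub_truncatedExpansion hd hkn hr]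
  refine (diamondNorm_sum_smul_le _ _ fun s _ =>
    (isChannel_clone hd _).comp (isChannel_measurePrepare hd n _)).trans_eq ?_
  simp [truncationError]

theorem traceNorm_partialTrace_sub_le (hd : 1 ≤ d) {n k r : ℕ} (hkn : k ≤ n) (hr : r ≤ k)
    {ρ : Sym d n →L[ℂ] Sym d n} (hρ : IsState ρ) :
    traceNorm (partialTrace d hkn ρ - ∑ s ∈ Finset.range (r + 1), ((qHat d n k (k - s) : ℝ) : ℂ) •
      clone d (Nat.sub_le k s) (measurePrepare d n (k - s) ρ)) ≤ truncationError d n k r := by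
  have h := congrArg (fun L => L ρ) (partialTrace_sub_truncatedExpansion hd hkn hr)
  simp only [LinearMap.sub_apply, truncatedExpansion, LinearMap.sum_apply, LinearMap.smul_apply,
    LinearMap.comp_apply] at h
  rw [h]
  refine (traceNorm_sum_smul_state_le _ _ fun s _ => (isChannel_clone hd _).isState
    ((isChannel_measurePrepare hd n _).isState hρ)).trans_eq ?_
  simp [truncationError]

end Truncation

end DeFinetti

end

theorem mainTheorem3 (d n k : ℕ) (hd : 1 ≤ d) (hk : 1 ≤ k) (hkn : k < n) :
    (DeFinetti.deltaParam d n k < 1 / 3 ↔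
      (k : ℝ) < (Real.sqrt (12 * n + (3 * d - 2) ^ 2) + 4 - 3 * d) / 6) ∧
    (DeFinetti.deltaParam d n k < 1 / 3 → ∀ (r : ℕ) (hr : r ≤ k),
      -- the diamond norm estimate
      DeFinetti.diamondNorm
          (DeFinetti.partialTrace d hkn.le - DeFinetti.truncatedExpansion d n k r) ≤
        ENNReal.ofReal (DeFinetti.truncationError d n k r) ∧
      DeFinetti.truncationError d n k r ≤
        DeFinetti.deltaParam d n k ^ (r + 1) / (1 - 3 * DeFinetti.deltaParam d n k) ∧
      -- the consequence for the marginals of symmetric states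
      ∀ ρ : DeFinetti.Sym d n →L[ℂ] DeFinetti.Sym d n, DeFinetti.IsState ρ →
        (∀ s ≤ r, DeFinetti.clone d (Nat.sub_le k s) (DeFinetti.measurePrepare d n (k - s) ρ) ∈
          DeFinetti.almostProductStates d k r hr) ∧
        DeFinetti.traceNorm (DeFinetti.partialTrace d hkn.le ρ -
            ∑ s ∈ Finset.range (r + 1), ((DeFinetti.qHat d n k (k - s) : ℝ) : ℂ) •
              DeFinetti.clone d (Nat.sub_le k s) (DeFinetti.measurePrepare d n (k - s) ρ)) ≤
          DeFinetti.truncationError d n k r) := by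
  refine ⟨DeFinetti.deltaParam_lt_iff hd hk, fun hδ r hr => ⟨?_, ?_, fun ρ hρ => ⟨?_, ?_⟩⟩⟩
  · exact DeFinetti.diamondNorm_partialTrace_sub_le hd hkn.le hr
  · exact DeFinetti.truncationError_le hd hk hkn hδ r
  · exact fun s hs => DeFinetti.clone_measurePrepare_mem_almostProductStates hd hr hs hρ
  · exact DeFinetti.traceNorm_partialTrace_sub_le hd hkn.le hr hρ
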